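/- Let $M\subset\mathbb C^n$ and $M'\subset\mathbb C^{n'}$ be connected generic real-analytic submanifolds (generic means $TM+iTM=\mathbb C^n$, and likewise for $M'$). Write $T^c_xM=T_xM\cap iT_xM$. Let $x\in M$ and let $M$ be given near $x$ by real-analytic equations $\rho_1(z,\bar z)=\dots=\rho_d(z,\bar z)=0$ with $\partial\rho_1\wedge\dots\wedge\partial\rho_d\neq0$ at $x$. Its complexification is (the germ at $(x,\bar x)$ of) $\mathcal M=\{(z,\bar w):\rho_1(z,\bar w)=\dots=\rho_d(z,\bar w)=0\}\subset\mathbb C^n\times\overline{\mathbb C^n}$, where $\rho_j(z,\bar w)$ is the holomorphic function of $(z,\bar w)$ that extends $\rho_j(z,\bar z)$; the Segre varieties are $Q_w=\{z:(z,\bar w)\in\mathcal M\}$ for $w$ near $x$. The same objects are defined for $M'$ near each of its points. A manifold $M'\subset\mathbb C^{n'}$ as above, of codimension $d'$, is called $r$-nondegenerate at $x'\in M'$, where $r\ge1$, if the antiholomorphic map $w'\mapsto j^r_{x'}(Q'_{w'})$ from $Q'_{x'}$ to the space of $r$-jets at $x'$ of complex submanifolds of codimension $d'$ through $x'$ has rank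 $n'-d'=\dim Q'_{x'}$ at $x'$. A germ $f$ at $x$ of a holomorphic map from a neighborhood of $x$ in $\mathbb C^n$ to $\mathbb C^{n'}$ is called admissible if $f(M)\subset M'$ (as germs at $x$) and $df(T^c_xM)=T^c_{f(x)}M'$. Let $J^k(\mathbb C^n,\mathbb C^{n'})$ be the bundle of $k$-jets $j^k_zf$ of holomorphic maps at all points $z\in\mathbb C^n$, $J^k_z$ its fibre over $z$, and $\bar f(\bar w)=\overline{f(w)}$. Let $f_0$ be an admissible germ at $x$, put $x'=f_0(x)$, and suppose that $M'$ is $r$-nondegenerate at $x'$. Then for every integer $k\ge0$ there exist an open neighborhood $U\subset J^{k+r}(\mathbb C^n,\mathbb C^{n'})$ of $j^{k+r}_xf_0$, an open neighborhood $U(x,\bar x)$ of $(x,\bar x)$ in $\mathcal M$ and, for every $(z,\bar w)\in U(x,\bar x)$, a holomorphic map $$F^k_{(z,\bar w)}\colon U_z:=U\cap J^{k+r}_z(\mathbb C^n,\mathbb C^{n'})\to J^k_{\bar w}(\overline{\mathbb C^n},\overline{\mathbb C^{n'}}),$$ depending holomorphically on $(z,\bar w)\in U(x,\bar x)$ (that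 is, $(z,\bar w,j)\mapsto F^k_{(z,\bar w)}(j)$ is holomorphic on $\{(z,\bar w,j):(z,\bar w)\in U(x,\bar x),\ j\in U_z\}$), such that for every admissible germ $f$ at $x$ with $j^{k+r}_xf\in U$ one has $j^{k+r}_zf\in U_z$ and $$j^k_{\bar w}\bar f=F^k_{(z,\bar w)}(j^{k+r}_zf)$$ for all $(z,\bar w)\in\mathcal M$ sufficiently close to $(x,\bar x)$, where how close may depend on $f$. -/

import Mathlib

open Filter Topology

noncomputable section

namespace CRJets

/-- The space `ℂⁿ`. -/
abbrev Cn (n : ℕ) : Type := Fin n → ℂ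

/-! ### Submanifolds of `ℂⁿ` -/

/-- The tangent space `T_p M`: velocity vectors at `p` of curves in `M` through `p`. -/
def tangentVectors {n : ℕ} (M : Set (Cn n)) (p : Cn n) : Set (Cn n) :=
  {v | ∃ γ : ℝ → Cn n, γ 0 = p ∧ (∀ᶠ t in 𝓝 (0 : ℝ), γ t ∈ M) ∧ HasDerivAt γ v 0}

/-- The complex tangent space `T^c_p M = T_p M ∩ i T_p M`. -/
def complexTangent {n : ℕ} (M : Set (Cn n)) (p : Cn n) : Set (Cn n) :=
  {v | v ∈ tangentVectors M p ∧ ∃ u ∈ tangentVectors M p, v = Complex.I • u}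

/-- Real-analytic submanifolds of `ℂⁿ`: near each of its points `M` is the zero set of finitely
many real-analytic functions with linearly independent differentials (in particular `M` is locally
closed). -/
def IsRealAnalyticSubmanifold {n : ℕ} (M : Set (Cn n)) : Prop :=
  ∀ p ∈ M, ∃ (d : ℕ) (ρ : Cn n → Fin d → ℝ), AnalyticAt ℝ ρ p ∧
    (∀ᶠ z in 𝓝 p, z ∈ M ↔ ρ z = 0) ∧
    LinearIndependent ℝ (fun j : Fin d => fderiv ℝ (fun z => ρ z j) p)

/-- Connected generic real-analytic submanifolds of `ℂⁿ`; generic means `TM + i TM = ℂⁿ`.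
Such an `M` is automatically a CR manifold: `T^c M` has constant dimension. -/
structure IsGeneric {n : ℕ} (M : Set (Cn n)) : Prop where
  connected : IsConnected M
  analytic : IsRealAnalyticSubmanifold M
  generic : ∀ p ∈ M, ∀ v : Cn n,
    ∃ a ∈ tangentVectors M p, ∃ b ∈ tangentVectors M p, v = a + Complex.I • b

/-- The `(1,0)`-form `∂g` at `p` of a real-valued function `g`:
`∂g (v) = (dg (v) - i dg (i v)) / 2`. -/
def del {n : ℕ} (g : Cn n → ℝ) (p v : Cn n) : ℂ :=
  ((fderiv ℝ g p v : ℂ) - Complex.I * (fderiv ℝ g p (Complex.I • v) : ℂ)) / 2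

/-- `M` is defined near `x` by real-analytic equations `ρ₁ = ⋯ = ρ_d = 0` with
`∂ρ₁ ∧ ⋯ ∧ ∂ρ_d ≠ 0`. -/
structure IsDefining {n d : ℕ} (M : Set (Cn n)) (x : Cn n) (ρ : Cn n → Fin d → ℝ) : Prop where
  analytic : AnalyticAt ℝ ρ x
  zero_set : ∀ᶠ z in 𝓝 x, z ∈ M ↔ ρ z = 0
  independent : LinearIndependent ℂ (fun j : Fin d => del (fun z => ρ z j) x)

/-- `R (z, ζ)` is the holomorphic function near `(x, x̄)` obtained from the power series of
`ρ = ρ (z, z̄)` on replacing `z̄` by an independent variable `ζ`. Points `w̄` of the conjugate space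
are written as vectors `ζ = star w` of `ℂⁿ`. -/
structure IsPolarization {n d : ℕ} (x : Cn n) (ρ : Cn n → Fin d → ℝ)
    (R : Cn n × Cn n → Cn d) : Prop where
  analytic : AnalyticAt ℂ R (x, star x)
  diagonal : ∀ᶠ z in 𝓝 x, R (z, star z) = fun j => (ρ z j : ℂ)

/-- The complexification `{(z, w̄) : ρ (z, w̄) = 0}`; only its germ at `(x, x̄)` is relevant. -/
def complexification {n d : ℕ} (R : Cn n × Cn n → Cn d) : Set (Cn n × Cn n) :=
  {p | R p = 0}

/-! ### Jets of holomorphic maps -/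

/-- Multi-indices of order at most `k` in `n` variables; a multi-index of order `m` is written as
the nondecreasing sequence `σ₁ ≤ ⋯ ≤ σ_m` of the variables with respect to which one
differentiates. -/
abbrev JetIndex (n k : ℕ) : Type :=
  Σ m : Fin (k + 1), {σ : Fin m → Fin n // Monotone σ}

/-- The space of `k`-jets at a given point of maps from `ℂⁿ` to `ℂᵖ`, in the coordinates given by
the partial derivatives of order at most `k`. -/
abbrev JetFiber (n p k : ℕ) : Type := JetIndex n k → Cn p

/-- The (trivial) bundle `J^k(ℂⁿ, ℂᵖ)` of `k`-jets at all points of `ℂⁿ`. -/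
abbrev JetBundle (n p k : ℕ) : Type := Cn n × JetFiber n p k

/-- The coordinates of the `k`-jet `j^k_z f`: all partial derivatives
`∂^m f / ∂z_{σ₁} ⋯ ∂z_{σ_m}` at `z` with `m ≤ k`. -/
def jet {n p : ℕ} (k : ℕ) (f : Cn n → Cn p) (z : Cn n) : JetFiber n p k :=
  fun σ => iteratedFDeriv ℂ (σ.1 : ℕ) f z (fun i => Pi.single (σ.2.1 i) 1)

/-- The map `f̄ (w̄) = conj (f (w))`, holomorphic in `ζ = w̄`. -/
def conjMap {n p : ℕ} (f : Cn n → Cn p) : Cn n → Cn p := fun ζ => star (f (star ζ))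

/-! ### Segre varieties and finite nondegeneracy -/

/-- In the linear coordinates `z = L (u, v)` of `ℂⁿ`, all Segre varieties
`Q_w = {z : R (z, w̄) = 0}` with `w` near `x` are near `x` the graphs `v = Φ (u, w̄)`. -/
structure IsSegreGraph {n m d : ℕ} (x : Cn n) (R : Cn n × Cn n → Cn d)
    (L : (Cn m × Cn d) ≃L[ℂ] Cn n) (Φ : Cn m × Cn n → Cn d) : Prop where
  analytic : AnalyticAt ℂ Φ ((L.symm x).1, star x)
  graph : ∀ᶠ q : (Cn m × Cn d) × Cn n in 𝓝 (L.symm x, star x),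
    R (L q.1, q.2) = 0 ↔ q.1.2 = Φ (q.1.1, q.2)

/-- `M` is `k`-nondegenerate at `x`: `k ≥ 1` and the map `w ↦ j^k_x Q_w` on `Q_x` has rank
`dim Q_x = n - d` at `x`. Here `n - d = m`; jets at `x` of submanifolds of codimension `d`
(near `j^k_x Q_x`) have as coordinates the jets of the functions whose graphs they are; and the
antiholomorphic map is written as a holomorphic function of `ζ = w̄`, where
`w ∈ Q_x` if and only if `x ∈ Q_w`, i.e. `R (x, ζ) = 0`, so that the tangent space of
the conjugate of `Q_x` is the kernel of the `ζ`-derivative of `R`. -/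
def IsNondegenerateAt {n : ℕ} (M : Set (Cn n)) (k : ℕ) (x : Cn n) : Prop :=
  1 ≤ k ∧ x ∈ M ∧
  ∃ (m d : ℕ) (ρ : Cn n → Fin d → ℝ) (R : Cn n × Cn n → Cn d)
    (L : (Cn m × Cn d) ≃L[ℂ] Cn n) (Φ : Cn m × Cn n → Cn d),
    IsDefining M x ρ ∧ IsPolarization x ρ R ∧ IsSegreGraph x R L Φ ∧
    Module.finrank ℂ (Submodule.map
      (fderiv ℂ (fun ζ => jet k (fun u => Φ (u, ζ)) (L.symm x).1) (star x)).toLinearMap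
      (LinearMap.ker (fderiv ℂ (fun ζ => R (x, ζ)) (star x)).toLinearMap)) = m

/-! ### Admissible germs -/

/-- `f` represents an admissible germ at `x`: it is holomorphic near `x`, the germ of `M` at `x` is
mapped into `M'`, and `df (T^c_x M) = T^c_{f(x)} M'`. -/
structure IsAdmissible {n n' : ℕ} (M : Set (Cn n)) (M' : Set (Cn n')) (x : Cn n)
    (f : Cn n → Cn n') : Prop where
  analytic : AnalyticAt ℂ f x
  maps : ∀ᶠ z in 𝓝[M] x, f z ∈ M'
  tangent : fderiv ℂ f x '' complexTangent M x = complexTangent M' (f x)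

end CRJets

end

/-!
The heart of the matter is an identity `f̄ (ζ) = G (t, ζ, j^r f (ψ (t, ζ)))`, with one analytic `G`
for all admissible `f` whose `r`-jet at `x` is close to that of `f₀`. `M` is a maximally real
submanifold of its complexification, so `f (M) ⊆ M'` extends to the statement that `f` maps the
Segre variety of `ζ` into the Segre variety of `f̄ (ζ)` (`IsAdmissible.eventually_graphDefect`).
Near `x` the former is parametrised by `t ↦ ψ (t, ζ)` (`IsPolarization.exists_segre_param`) and the
latter is the graph `v = Φ (u, ζ')` with `ζ' = f̄ (ζ)`; hence the function
`t ↦ v (f (ψ (t, ζ))) - Φ (u (f (ψ (t, ζ))), ζ')` vanishes identically. Its `r`-jet at `t` depends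
on `f` only through the `r`-jet of `f` at `z = ψ (t, ζ)`, so `f` may be replaced by its Taylor
polynomial there. This gives a system of analytic equations for `ζ'` with parameters `t`, `ζ` and
the jet (`reflectionSystem`).

The `ζ'`-derivative of the system is injective at the base point (`reflectionSystem_injective`).
Since `df₀` maps `T^c_x M` onto `T^c_{x'} M'`, the map `t ↦ u (f₀ (ψ (t, x̄)))` is a submersion;
composing with a local section of it recovers the jet of `Φ (·, ζ')` from the jet of the pull-back
(`fderiv_jet_eq_zero_of_pullback`), and `ζ' ↦ j^r Φ (·, ζ')` is an immersion by nondegeneracy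
(`IsSegreGraph.jet_immersion`). The implicit function theorem then yields `G`
(`exists_reflection`).

Differentiating the identity `k` times in `ζ` with `t` fixed gives `j^k f̄`. Its value at
`(z, ζ)` involves only the `k`-jet at `z` of `w ↦ j^r_w f`, that is, the `(k + r)`-jet of `f`
at `z`; so `F^k` is obtained by inserting the Taylor polynomial of a given jet (`reflectionJet`).

All comparisons of jets go through the relation `Contact k f g x`, that is
`f - g = O(‖y - x‖ ^ (k + 1))`, which is visibly stable under composition, so that the chain rule
for higher derivatives is never needed.
-/

noncomputable section

namespace CRJets

/-! ### Contact of analytic maps -/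

open Asymptotics

section Contact

variable {E F G : Type*} [NormedAddCommGroup E] [NormedAddCommGroup F] [NormedAddCommGroup G]

/-- `f` and `g` agree to order `k` at `x`: `f - g = O(‖y - x‖ ^ (k + 1))`. -/
def Contact (k : ℕ) (f g : E → F) (x : E) : Prop :=
  (fun y => f y - g y) =O[𝓝 x] fun y => ‖y - x‖ ^ (k + 1)

theorem Contact.of_eventuallyEq {k : ℕ} {f g : E → F} {x : E} (h : f =ᶠ[𝓝 x] g) :
    Contact k f g x := by
  refine IsBigO.congr' (isBigO_zero _ _) ?_ EventuallyEq.rfl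
  filter_upwards [h] with y hy using by simp [hy]

theorem Contact.symm {k : ℕ} {f g : E → F} {x : E} (h : Contact k f g x) : Contact k g f x := by
  simpa [Contact] using IsBigO.neg_left h

theorem Contact.trans {k : ℕ} {f g e : E → F} {x : E} (h : Contact k f g x)
    (h' : Contact k g e x) : Contact k f e x := by
  simpa [Contact] using IsBigO.add h h'

theorem isBigO_norm_sub_pow_of_le {x : E} {a b : ℕ} (h : a ≤ b) :
    (fun y : E => ‖y - x‖ ^ b) =O[𝓝 x] fun y => ‖y - x‖ ^ a := by
  have h1 : Tendsto (fun y : E => ‖y - x‖) (𝓝 x) (𝓝 0) := by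
    have : ContinuousAt (fun y : E => ‖y - x‖) x := by fun_prop
    simpa [ContinuousAt] using this
  obtain ⟨c, rfl⟩ := Nat.exists_eq_add_of_le h
  have h2 : (fun y : E => ‖y - x‖ ^ c) =O[𝓝 x] fun _ => (1 : ℝ) :=
    (h1.pow c).isBigO_one ℝ
  simpa [pow_add] using (isBigO_refl (fun y : E => ‖y - x‖ ^ a) (𝓝 x)).mul h2

theorem Contact.of_le {k l : ℕ} {f g : E → F} {x : E} (h : Contact k f g x) (hl : l ≤ k) :
    Contact l f g x :=
  IsBigO.trans h (isBigO_norm_sub_pow_of_le (by omega))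

theorem Contact.apply_eq {k : ℕ} {f g : E → F} {x : E} (h : Contact k f g x) : f x = g x := by
  have := IsBigO.eq_zero_of_norm_pow h (Nat.succ_ne_zero k)
  exact sub_eq_zero.1 this

theorem Contact.comp_left [NormedSpace ℂ F] [NormedSpace ℂ G] [CompleteSpace G] {k : ℕ}
    {f g : E → F} {x : E} {Φ : F → G}
    (hfg : Contact k f g x) (hΦ : AnalyticAt ℂ Φ (f x)) (hf : ContinuousAt f x)
    (hg : ContinuousAt g x) :
    Contact k (fun s => Φ (f s)) (fun s => Φ (g s)) x := by
  have h1 := hΦ.hasStrictFDerivAt.isBigO_sub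
  have h2 : Tendsto (fun s => (f s, g s)) (𝓝 x) (𝓝 (f x, f x)) := by
    have := hf.tendsto.prodMk_nhds hg.tendsto
    rwa [← hfg.apply_eq] at this
  exact (h1.comp_tendsto h2).trans hfg

theorem Contact.comp_right [NormedSpace ℂ E] [NormedSpace ℂ G] {k : ℕ} {f g : E → F}
    {h : G → E} {t : G}
    (hfg : Contact k f g (h t)) (hh : DifferentiableAt ℂ h t) :
    Contact k (fun s => f (h s)) (fun s => g (h s)) t := by
  have h1 := IsBigO.comp_tendsto hfg hh.continuousAt.tendsto
  refine h1.trans ?_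
  exact (hh.isBigO_sub.norm_norm.pow (k + 1))

variable [NormedSpace ℂ E] [NormedSpace ℂ F] [NormedSpace ℂ G]

theorem iteratedFDeriv_eq_zero_of_isBigO [CompleteSpace F] {h : E → F} {x : E} {k : ℕ}
    (hh : AnalyticAt ℂ h x) (hO : h =O[𝓝 x] fun y => ‖y - x‖ ^ (k + 1)) {m : ℕ} (hm : m ≤ k) :
    iteratedFDeriv ℂ m h x = 0 := by
  obtain ⟨p, hp⟩ := hh
  have hO' : (fun y => h (x + y)) =O[𝓝 0] fun y : E => ‖y‖ ^ (k + 1) := by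
    have ht : Tendsto (fun y : E => x + y) (𝓝 0) (𝓝 x) := by
      have : ContinuousAt (fun y : E => x + y) 0 := by fun_prop
      simpa [ContinuousAt] using this
    simpa [Function.comp_def] using hO.comp_tendsto ht
  have key : ∀ j : ℕ, j ≤ k → ∀ y : E, (p j fun _ => y) = 0 := by
    intro j
    induction j using Nat.strong_induction_on with
    | _ j IH =>
      intro hj
      have psum_eq : p.partialSum (j + 1) = fun y => p j fun _ => y := by
        funext z
        refine Finset.sum_eq_single _ (fun b hb hnb => ?_) fun hn => ?_
        · have := Finset.mem_range_succ_iff.mp hb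
          exact IH b (this.lt_of_ne hnb) (by omega) z
        · exact False.elim (hn (Finset.mem_range.mpr (Nat.lt_succ_self j)))
      have h1 := hp.isBigO_sub_partialSum_pow (j + 1)
      rw [psum_eq] at h1
      have h2 : (fun y : E => ‖y‖ ^ (k + 1)) =O[𝓝 0] fun y => ‖y‖ ^ (j + 1) := by
        simpa using isBigO_norm_sub_pow_of_le (x := (0 : E)) (show j + 1 ≤ k + 1 by omega)
      have h3 := (hO'.trans h2).sub h1
      simp only [sub_sub_cancel] at h3
      exact h3.continuousMultilinearMap_apply_eq_zero
  obtain ⟨s, hs⟩ := hp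
  ext v
  rw [hs.iteratedFDeriv_eq_sum_of_completeSpace, ← (p m).iteratedFDeriv_comp_diagonal x v,
    show (fun y => p m fun _ => y) = fun _ => 0 from funext (key m hm)]
  simp

theorem Contact.iteratedFDeriv_eq [CompleteSpace F] {k : ℕ} {f g : E → F} {x : E}
    (h : Contact k f g x) (hf : AnalyticAt ℂ f x) (hg : AnalyticAt ℂ g x) {m : ℕ} (hm : m ≤ k) :
    iteratedFDeriv ℂ m f x = iteratedFDeriv ℂ m g x := by
  have h1 := iteratedFDeriv_eq_zero_of_isBigO (hf.sub hg) h hm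
  rw [iteratedFDeriv_sub_apply hf.contDiffAt hg.contDiffAt] at h1
  exact sub_eq_zero.1 h1

theorem contact_taylor [CompleteSpace F] {f : E → F} {x : E} (hf : AnalyticAt ℂ f x) (k : ℕ) :
    Contact k f (fun y => ∑ m ∈ Finset.range (k + 1), (m.factorial : ℂ)⁻¹ •
      iteratedFDeriv ℂ m f x (fun _ => y - x)) x := by
  obtain ⟨p, hp⟩ := hf
  have h1 := hp.isBigO_sub_partialSum_pow (k + 1)
  have ht : Tendsto (fun y : E => y - x) (𝓝 x) (𝓝 0) := by
    have : ContinuousAt (fun y : E => y - x) x := by fun_prop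
    simpa [ContinuousAt] using this
  have h2 := h1.comp_tendsto ht
  obtain ⟨s, hs⟩ := hp
  refine h2.congr_left fun y => ?_
  simp only [Function.comp, add_sub_cancel, FormalMultilinearSeries.partialSum]
  congr 1
  refine Finset.sum_congr rfl fun m _ => ?_
  rw [← hs.factorial_smul, ← Nat.cast_smul_eq_nsmul ℂ, smul_smul,
    inv_mul_cancel₀ (by exact_mod_cast m.factorial_ne_zero), one_smul]

theorem contact_of_iteratedFDeriv_eq [CompleteSpace F] {k : ℕ} {f g : E → F} {x : E}
    (hf : AnalyticAt ℂ f x) (hg : AnalyticAt ℂ g x)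
    (h : ∀ m ≤ k, iteratedFDeriv ℂ m f x = iteratedFDeriv ℂ m g x) : Contact k f g x := by
  refine (contact_taylor hf k).trans (Contact.trans ?_ (contact_taylor hg k).symm)
  refine Contact.of_eventuallyEq (Eventually.of_forall fun y => Finset.sum_congr rfl fun m hm => ?_)
  rw [h m (Finset.mem_range_succ_iff.1 hm)]

theorem Contact.fderiv [CompleteSpace F] {k : ℕ} {f g : E → F} {x : E} (h : Contact (k + 1) f g x)
    (hf : AnalyticAt ℂ f x) (hg : AnalyticAt ℂ g x) :
    Contact k (fderiv ℂ f) (fderiv ℂ g) x := by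
  refine contact_of_iteratedFDeriv_eq hf.fderiv hg.fderiv fun m hm => ?_
  have h1 := h.iteratedFDeriv_eq hf hg (Nat.succ_le_succ hm)
  rw [iteratedFDeriv_succ_eq_comp_right, iteratedFDeriv_succ_eq_comp_right] at h1
  exact (continuousMultilinearCurryRightEquiv' ℂ m E F).symm.injective h1

theorem analyticAt_iteratedFDeriv [CompleteSpace F] {f : E → F} {x : E} (hf : AnalyticAt ℂ f x)
    (m : ℕ) : AnalyticAt ℂ (iteratedFDeriv ℂ m f) x := by
  have h : AnalyticOnNhd ℂ f {y | AnalyticAt ℂ f y} := fun y hy => hy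
  exact h.iteratedFDeriv m x hf

theorem Contact.iteratedFDeriv [CompleteSpace F] {k m : ℕ} {f g : E → F} {x : E}
    (h : Contact (k + m) f g x) (hf : AnalyticAt ℂ f x) (hg : AnalyticAt ℂ g x) :
    Contact k (iteratedFDeriv ℂ m f) (iteratedFDeriv ℂ m g) x := by
  induction m generalizing k with
  | zero =>
    rw [iteratedFDeriv_zero_eq_comp, iteratedFDeriv_zero_eq_comp]
    exact h.comp_left (Φ := (continuousMultilinearCurryFin0 ℂ E F).symm)
      ((continuousMultilinearCurryFin0 ℂ E F).symm.toContinuousLinearEquiv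
        |>.toContinuousLinearMap.analyticAt _) hf.continuousAt hg.continuousAt
  | succ m IH =>
    have h1 := (IH (k := k + 1) (by rwa [add_right_comm, add_assoc])).fderiv
      (analyticAt_iteratedFDeriv hf m) (analyticAt_iteratedFDeriv hg m)
    rw [iteratedFDeriv_succ_eq_comp_left, iteratedFDeriv_succ_eq_comp_left]
    have h2 (y) : AnalyticAt ℂ
        (continuousMultilinearCurryLeftEquiv ℂ (fun _ : Fin (m + 1) => E) F).symm y :=
      LinearIsometryEquiv.analyticAt _ _
    exact h1.comp_left (h2 _)
      (analyticAt_iteratedFDeriv hf m).fderiv.continuousAt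
      (analyticAt_iteratedFDeriv hg m).fderiv.continuousAt

/-- Chain rule for a linear inner map, with analyticity required only at the point in question. -/
theorem iteratedFDeriv_comp_clm [CompleteSpace F] {f : E → F} (g : G →L[ℂ] E) {x : G}
    (hf : AnalyticAt ℂ f (g x)) (m : ℕ) :
    iteratedFDeriv ℂ m (fun y => f (g y)) x =
      (iteratedFDeriv ℂ m f (g x)).compContinuousLinearMap fun _ => g := by
  have ho : IsOpen {y | AnalyticAt ℂ f y} := isOpen_analyticAt ℂ f
  have ho' : IsOpen (g ⁻¹' {y | AnalyticAt ℂ f y}) := ho.preimage g.continuous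
  have h : ContDiffOn ℂ m f {y | AnalyticAt ℂ f y} :=
    AnalyticOnNhd.contDiffOn (fun y hy => hy) ho.uniqueDiffOn
  have := g.iteratedFDerivWithin_comp_right h ho.uniqueDiffOn ho'.uniqueDiffOn (x := x) hf le_rfl
  rw [iteratedFDerivWithin_of_isOpen m ho hf,
    iteratedFDerivWithin_of_isOpen m ho' (show x ∈ _ from hf)] at this
  exact this

theorem iteratedFDeriv_slice [CompleteSpace F] {h : E × G → F} {t : E} {q : G}
    (hh : AnalyticAt ℂ h (t, q)) (m : ℕ) (v : Fin m → E) :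
    iteratedFDeriv ℂ m (fun s => h (s, q)) t v =
      iteratedFDeriv ℂ m h (t, q) (fun i => (v i, 0)) := by
  have h1 : AnalyticAt ℂ (fun y => h (y + (0, q))) (ContinuousLinearMap.inl ℂ E G t) := by
    refine AnalyticAt.fun_comp (g := h) ?_ (analyticAt_id.add analyticAt_const)
    simpa using hh
  have h2 := iteratedFDeriv_comp_clm (ContinuousLinearMap.inl ℂ E G) h1 m
  have h3 : (fun y => (fun y => h (y + (0, q))) (ContinuousLinearMap.inl ℂ E G y))
    = fun s => h (s, q) := by ext s; simp
  rw [h3, iteratedFDeriv_comp_add_right] at h2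
  rw [h2]
  simp

end Contact

/-! ### Jets, Taylor polynomials and implicit functions -/

section Projections

variable {E F G : Type*} [NormedAddCommGroup E] [NormedSpace ℂ E]
  [NormedAddCommGroup F] [NormedSpace ℂ F] [NormedAddCommGroup G] [NormedSpace ℂ G]

@[fun_prop]
theorem analyticAt_comp_fst {f : E → F × G} {a : E} (hf : AnalyticAt ℂ f a) :
    AnalyticAt ℂ (fun b => (f b).1) a :=
  AnalyticAt.comp (g := Prod.fst) (f := f) analyticAt_fst hf

@[fun_prop]
theorem analyticAt_comp_snd {f : E → F × G} {a : E} (hf : AnalyticAt ℂ f a) :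
    AnalyticAt ℂ (fun b => (f b).2) a :=
  AnalyticAt.comp (g := Prod.snd) (f := f) analyticAt_snd hf

end Projections

section Jets

variable {n p k l : ℕ} {Q : Type*} [NormedAddCommGroup Q] [NormedSpace ℂ Q]

theorem Contact.jet_eq {f g : Cn n → Cn p} {z : Cn n} (h : Contact k f g z)
    (hf : AnalyticAt ℂ f z) (hg : AnalyticAt ℂ g z) : jet k f z = jet k g z := by
  funext σ
  simp only [jet]
  rw [h.iteratedFDeriv_eq hf hg (Nat.lt_succ_iff.1 σ.1.2)]

theorem jet_zero (z : Cn n) : jet k (fun _ => (0 : Cn p)) z = 0 := by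
  funext σ
  simp [jet]

theorem analyticAt_jet {f : Cn n → Cn p} {z : Cn n} (hf : AnalyticAt ℂ f z) :
    AnalyticAt ℂ (jet k f) z := by
  refine AnalyticAt.pi fun σ => ?_
  exact ((ContinuousMultilinearMap.apply ℂ (fun _ : Fin σ.1 => Cn n) (Cn p)
    (fun i => Pi.single (σ.2.1 i) 1)).analyticAt _).comp (analyticAt_iteratedFDeriv hf _)

/-- Jets of an analytic family of maps depend analytically on the base point and the parameter. -/
theorem analyticAt_jet_slice {h : Cn n × Q → Cn p} {a : Cn n × Q} (hh : AnalyticAt ℂ h a) :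
    AnalyticAt ℂ (fun b : Cn n × Q => jet k (fun s => h (s, b.2)) b.1) a := by
  refine AnalyticAt.pi fun σ => ?_
  refine AnalyticAt.congr (((ContinuousMultilinearMap.apply ℂ (fun _ : Fin σ.1 => Cn n × Q) (Cn p)
    (fun i => (Pi.single (σ.2.1 i) 1, 0))).analyticAt _).comp
      (analyticAt_iteratedFDeriv hh σ.1)) ?_
  filter_upwards [hh.eventually_analyticAt] with b hb
  simp only [jet, Function.comp]
  rw [iteratedFDeriv_slice hb]
  rfl

theorem analyticAt_jet_comp {h : Cn n × Q → Cn p} {t : Q → Cn n} {a : Q}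
    (hh : AnalyticAt ℂ h (t a, a)) (ht : AnalyticAt ℂ t a) :
    AnalyticAt ℂ (fun b => jet k (fun s => h (s, b)) (t b)) a :=
  AnalyticAt.comp (g := fun c : Cn n × Q => jet k (fun s => h (s, c.2)) c.1)
    (f := fun b => (t b, b)) (analyticAt_jet_slice hh) (ht.prod analyticAt_id)

/-- A contact of order `k + l` between two maps is a contact of order `k` between their
`l`-jets. -/
theorem Contact.jet {f g : Cn n → Cn p} {z : Cn n} (h : Contact (k + l) f g z)
    (hf : AnalyticAt ℂ f z) (hg : AnalyticAt ℂ g z) : Contact k (jet l f) (jet l g) z := by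
  refine Asymptotics.isBigO_pi.2 fun σ => ?_
  have h1 : Contact k (_root_.iteratedFDeriv ℂ (σ.1 : ℕ) f)
      (_root_.iteratedFDeriv ℂ (σ.1 : ℕ) g) z :=
    (h.of_le (by have := σ.1.2; omega)).iteratedFDeriv hf hg
  exact h1.comp_left ((ContinuousMultilinearMap.apply ℂ (fun _ : Fin σ.1 => Cn n) (Cn p)
    (fun i => Pi.single (σ.2.1 i) 1)).analyticAt _) (analyticAt_iteratedFDeriv hf _).continuousAt
    (analyticAt_iteratedFDeriv hg _).continuousAt

/-- The value of a map, as a component of its `k`-jet. -/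
def jetValue (n p k : ℕ) : JetFiber n p k →L[ℂ] Cn p :=
  ContinuousLinearMap.proj ⟨0, Fin.elim0, fun i => i.elim0⟩

theorem jetValue_jet (f : Cn n → Cn p) (z : Cn n) : jetValue n p k (jet k f z) = f z := by
  exact iteratedFDeriv_zero_apply (𝕜 := ℂ) (f := f) (x := z) fun i => Pi.single (i.elim0 : Fin n) 1

/-- The Taylor polynomial `w ↦ ∑ (w - z)^α / α! • j_α` centred at `z` with coefficients the jet `j`.
The sum runs over all sequences `τ` of variables; `j` is evaluated at the sorted sequence. -/
def taylorPoly (z : Cn n) (j : JetFiber n p k) (w : Cn n) : Cn p :=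
  ∑ m : Fin (k + 1), ((m : ℕ).factorial : ℂ)⁻¹ • ∑ τ : Fin m → Fin n,
    (∏ i, (w - z) (τ i)) • j ⟨m, τ ∘ Tuple.sort τ, Tuple.monotone_sort τ⟩

theorem contact_taylorPoly {f : Cn n → Cn p} {z : Cn n} (hf : AnalyticAt ℂ f z) :
    Contact k f (taylorPoly z (jet k f z)) z := by
  refine (contact_taylor hf k).trans (Contact.of_eventuallyEq (Eventually.of_forall fun w => ?_))
  simp only [taylorPoly]
  rw [Finset.sum_range]
  refine Finset.sum_congr rfl fun m _ => ?_
  congr 1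
  have hw : (fun _ : Fin m => w - z) =
      fun _ => ∑ a : Fin n, (w - z) a • (Pi.single a (1 : ℂ) : Cn n) := by
    funext _
    exact pi_eq_sum_univ' (w - z)
  rw [hw, ContinuousMultilinearMap.map_sum]
  refine Finset.sum_congr rfl fun τ _ => ?_
  rw [ContinuousMultilinearMap.map_smul_univ]
  congr 1
  simp only [CRJets.jet]
  exact (ContDiffAt.iteratedFDeriv_comp_perm hf.contDiffAt
    (fun i => (Pi.single (τ i) (1 : ℂ) : Cn n)) (Tuple.sort τ)).symm

theorem analyticAt_taylorPoly (a : (Cn n × JetFiber n p k) × Cn n) :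
    AnalyticAt ℂ (fun a : (Cn n × JetFiber n p k) × Cn n => taylorPoly a.1.1 a.1.2 a.2) a := by
  simp only [taylorPoly, Pi.sub_apply]
  have hz (i : Fin n) : AnalyticAt ℂ (fun a : (Cn n × JetFiber n p k) × Cn n => a.1.1 i) a :=
    ((ContinuousLinearMap.proj (R := ℂ) i).comp ((ContinuousLinearMap.fst ℂ _ _).comp
      (ContinuousLinearMap.fst ℂ (Cn n × JetFiber n p k) (Cn n)))).analyticAt a
  have hw (i : Fin n) : AnalyticAt ℂ (fun a : (Cn n × JetFiber n p k) × Cn n => a.2 i) a :=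
    ((ContinuousLinearMap.proj (R := ℂ) i).comp
      (ContinuousLinearMap.snd ℂ (Cn n × JetFiber n p k) (Cn n))).analyticAt a
  have hj (σ : JetIndex n k) :
      AnalyticAt ℂ (fun a : (Cn n × JetFiber n p k) × Cn n => a.1.2 σ) a :=
    ((ContinuousLinearMap.proj (R := ℂ) σ).comp ((ContinuousLinearMap.snd ℂ _ _).comp
      (ContinuousLinearMap.fst ℂ (Cn n × JetFiber n p k) (Cn n)))).analyticAt a
  refine Finset.analyticAt_fun_sum _ fun m _ => AnalyticAt.fun_smul analyticAt_const ?_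
  refine Finset.analyticAt_fun_sum _ fun τ _ => AnalyticAt.fun_smul ?_ (hj _)
  exact Finset.analyticAt_fun_prod _ fun i _ => (hw _).sub (hz _)

theorem analyticAt_taylorPoly_right (z : Cn n) (j : JetFiber n p k) (w : Cn n) :
    AnalyticAt ℂ (taylorPoly z j) w :=
  (analyticAt_taylorPoly ((z, j), w)).along_snd

theorem analyticAt_taylorPoly_comp {z w : Q → Cn n} {j : Q → JetFiber n p k} {a : Q}
    (hz : AnalyticAt ℂ z a) (hj : AnalyticAt ℂ j a) (hw : AnalyticAt ℂ w a) :
    AnalyticAt ℂ (fun b => taylorPoly (z b) (j b) (w b)) a :=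
  AnalyticAt.comp (g := fun c : (Cn n × JetFiber n p k) × Cn n => taylorPoly c.1.1 c.1.2 c.2)
    (f := fun b => ((z b, j b), w b)) (analyticAt_taylorPoly _) ((hz.prod hj).prod hw)

end Jets

section Implicit

variable {P Y Y' : Type*} [NormedAddCommGroup P] [NormedSpace ℂ P] [CompleteSpace P]
  [NormedAddCommGroup Y] [NormedSpace ℂ Y] [NormedAddCommGroup Y'] [NormedSpace ℂ Y']

/-- The analytic implicit function theorem, with uniqueness in a neighbourhood of `(p, y)`. -/
theorem exists_implicit [CompleteSpace Y] [CompleteSpace Y'] {H : P × Y → Y'} {p : P} {y : Y}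
    (hH : AnalyticAt ℂ H (p, y))
    (h0 : H (p, y) = 0) (A : Y ≃L[ℂ] Y') (hA : HasFDerivAt (fun y => H (p, y)) (A : Y →L[ℂ] Y') y) :
    ∃ G : P → Y, AnalyticAt ℂ G p ∧ G p = y ∧ (∀ᶠ q in 𝓝 (p, y), H q = 0 ↔ q.2 = G q.1) ∧
      ∀ᶠ q in 𝓝 p, H (q, G q) = 0 := by
  have hc : ContDiffAt ℂ ⊤ H (p, y) := hH.contDiffAt
  have hinv : (fderiv ℂ H (p, y) ∘L .inr ℂ P Y).IsInvertible := by
    refine ⟨A, ?_⟩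
    have h1 : HasFDerivAt (fun y => (p, y)) (ContinuousLinearMap.inr ℂ P Y) y :=
      hasFDerivAt_prodMk_right p y
    exact hA.unique (HasFDerivAt.comp y hH.differentiableAt.hasFDerivAt h1)
  refine ⟨hc.implicitFunction (by simp) hinv,
    ?_, hc.implicitFunction_apply_self _ _, ?_, ?_⟩
  · exact (hc.contDiffAt_implicitFunction _ _).analyticAt
  · filter_upwards [hc.eventually_apply_eq_iff_implicitFunction (by simp) hinv] with q hq
    rw [← h0, hq, eq_comm]
  · have := hc.eventually_apply_implicitFunction (by simp) hinv
    rwa [h0] at this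

/-- An overdetermined analytic system `H (p, y) = 0` whose `y`-derivative is injective determines
`y` as an analytic function of `p`. -/
theorem exists_implicit_of_injective [FiniteDimensional ℂ Y] [FiniteDimensional ℂ Y']
    {H : P × Y → Y'} {p : P} {y : Y}
    (hH : AnalyticAt ℂ H (p, y)) (h0 : H (p, y) = 0) (A : Y →L[ℂ] Y')
    (hA : HasFDerivAt (fun y => H (p, y)) A y) (hinj : ∀ v, A v = 0 → v = 0) :
    ∃ G : P → Y, AnalyticAt ℂ G p ∧ G p = y ∧ ∀ᶠ q in 𝓝 (p, y), H q = 0 → q.2 = G q.1 := by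
  have : CompleteSpace Y := FiniteDimensional.complete ℂ Y
  obtain ⟨B, hB⟩ := (A : Y →ₗ[ℂ] Y').exists_leftInverse_of_injective
    (LinearMap.ker_eq_bot'.2 hinj)
  let B' := B.toContinuousLinearMap
  have hBA : B'.comp A = ContinuousLinearMap.id ℂ Y := by
    ext v
    exact LinearMap.congr_fun hB v
  obtain ⟨G, hG, hG0, hG1, -⟩ := exists_implicit (H := fun q => B' (H q)) (p := p) (y := y)
    ((B'.analyticAt _).comp hH) (by simp [h0]) (ContinuousLinearEquiv.refl ℂ Y)
    (by
      have := B'.hasFDerivAt.comp y hA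
      rwa [hBA] at this)
  refine ⟨G, hG, hG0, ?_⟩
  filter_upwards [hG1] with q hq h
  exact hq.1 (by simp [h])

end Implicit

/-! ### The differential of a polarized equation, and the identity theorem on `ζ = z̄` -/

section Derivative

variable {n d : ℕ} {x : Cn n} {ρ : Cn n → Fin d → ℝ} {R : Cn n × Cn n → Cn d}

/-- The derivative of `R (z, ζ)` with respect to `z` at the point `(x, x̄)`. -/
def holoDeriv (R : Cn n × Cn n → Cn d) (x : Cn n) : Cn n →L[ℂ] Cn d :=
  (fderiv ℂ R (x, star x)).comp (ContinuousLinearMap.inl ℂ (Cn n) (Cn n))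

/-- `dρ (v) = dR (v, v̄)`. -/
theorem IsPolarization.hasFDerivAt_diagonal (hR : IsPolarization x ρ R) (j : Fin d) :
    HasFDerivAt (𝕜 := ℝ) (fun z => (ρ z j : ℂ))
      (((ContinuousLinearMap.proj (R := ℝ) (φ := fun _ : Fin d => ℂ) j).comp
        ((fderiv ℂ R (x, star x)).restrictScalars ℝ)).comp
        ((ContinuousLinearMap.id ℝ (Cn n)).prod (starL' ℝ : Cn n ≃L[ℝ] Cn n))) x := by
  have h1 : HasFDerivAt (𝕜 := ℝ) (fun z : Cn n => (z, star z))
      ((ContinuousLinearMap.id ℝ (Cn n)).prod (starL' ℝ : Cn n ≃L[ℝ] Cn n)) x :=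
    ((ContinuousLinearMap.id ℝ (Cn n)).prod
      ((starL' ℝ : Cn n ≃L[ℝ] Cn n) : Cn n →L[ℝ] Cn n)).hasFDerivAt
  have h2 := hR.analytic.differentiableAt.hasFDerivAt.restrictScalars ℝ
  have h3 := ((ContinuousLinearMap.proj (R := ℝ) (φ := fun _ : Fin d => ℂ) j).hasFDerivAt.comp
    (x, star x) h2).comp x h1
  refine h3.congr_of_eventuallyEq ?_
  filter_upwards [hR.diagonal] with z hz
  simp [Function.comp, hz]

theorem IsPolarization.hasFDerivAt_re (hR : IsPolarization x ρ R) (j : Fin d) (v : Cn n) :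
    fderiv ℝ (fun z => ρ z j) x v = (fderiv ℂ R (x, star x) (v, star v) j).re := by
  have h := Complex.reCLM.hasFDerivAt.comp x (hR.hasFDerivAt_diagonal j)
  have h' : (⇑Complex.reCLM ∘ fun z => (ρ z j : ℂ)) = fun z => ρ z j := by
    ext z; simp
  rw [h'] at h
  rw [h.fderiv]
  rfl

theorem IsPolarization.differentiableAt (hR : IsPolarization x ρ R) (j : Fin d) :
    DifferentiableAt ℝ (fun z => ρ z j) x := by
  have h := Complex.reCLM.hasFDerivAt.comp x (hR.hasFDerivAt_diagonal j)
  exact h.differentiableAt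

theorem IsPolarization.fderiv_im (hR : IsPolarization x ρ R) (j : Fin d) (v : Cn n) :
    (fderiv ℂ R (x, star x) (v, star v) j).im = 0 := by
  have h := Complex.imCLM.hasFDerivAt.comp x (hR.hasFDerivAt_diagonal j)
  have h' : (⇑Complex.imCLM ∘ fun z => (ρ z j : ℂ)) = fun z => (0 : ℝ) := by
    ext z; simp
  rw [h'] at h
  have := h.unique (hasFDerivAt_const _ _)
  exact DFunLike.congr_fun this v

/-- As `ρ` is real valued, the `ζ`-derivative of `R` is conjugate to the `z`-derivative. -/
theorem IsPolarization.fderiv_apply (hR : IsPolarization x ρ R) (v η : Cn n) :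
    fderiv ℂ R (x, star x) (v, η) = holoDeriv R x v + star (holoDeriv R x (star η)) := by
  set F := fderiv ℂ R (x, star x) with hF
  have hsplit (v η : Cn n) : F (v, η) = F (v, 0) + F (0, η) := by
    rw [← map_add]; simp
  have key : F (0, η) = star (F (star η, 0)) := by
    funext j
    have h1 := hR.fderiv_im j (star η)
    have h2 := hR.fderiv_im j (Complex.I • star η)
    rw [← hF, hsplit] at h1 h2
    have e1 : F (Complex.I • star η, 0) = Complex.I • F (star η, 0) := by
      rw [← map_smul]; simp
    have e2 : F (0, star (Complex.I • star η)) = -Complex.I • F (0, η) := by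
      rw [← map_smul]; simp
    rw [e1, e2] at h2
    simp at h1 h2
    apply Complex.ext
    · simp; linarith
    · simp; linarith
  rw [hsplit, key]
  simp [holoDeriv, hF]

theorem IsPolarization.fderiv_eq_re (hR : IsPolarization x ρ R) (j : Fin d) (v : Cn n) :
    fderiv ℝ (fun z => ρ z j) x v = 2 * (holoDeriv R x v j).re := by
  rw [hR.hasFDerivAt_re, hR.fderiv_apply]
  simp
  ring

theorem IsPolarization.del_eq (hR : IsPolarization x ρ R) (j : Fin d) (v : Cn n) :
    del (fun z => ρ z j) x v = holoDeriv R x v j := by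
  simp only [del, hR.fderiv_eq_re, map_smul]
  apply Complex.ext <;> simp

/-- The condition `∂ρ₁ ∧ ⋯ ∧ ∂ρ_d ≠ 0` says that the `z`-derivative of `R` is onto. -/
theorem IsPolarization.exists_rightInverse (hR : IsPolarization x ρ R)
    (hi : LinearIndependent ℂ (fun j : Fin d => del (fun z => ρ z j) x)) :
    ∃ A : Cn d →L[ℂ] Cn n, ∀ c, holoDeriv R x (A c) = c := by
  have hs : LinearMap.range (holoDeriv R x : Cn n →ₗ[ℂ] Cn d) = ⊤ := by
    by_contra hne
    obtain ⟨φ, hφ, hle⟩ := Submodule.exists_le_ker_of_lt_top _ (lt_top_iff_ne_top.2 hne)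
    apply hφ
    have hz (v : Cn n) : φ (holoDeriv R x v) = 0 := hle ⟨v, rfl⟩
    have h0 : ∀ j, φ (Pi.single j 1) = 0 := by
      refine Fintype.linearIndependent_iff.1 hi (fun j => φ (Pi.single j 1)) ?_
      funext v
      have := hz v
      rw [pi_eq_sum_univ' (holoDeriv R x v), map_sum] at this
      simp only [map_smul, smul_eq_mul] at this
      simp only [Finset.sum_apply, Pi.smul_apply, smul_eq_mul, Pi.zero_apply, hR.del_eq]
      simpa only [mul_comm] using this
    refine LinearMap.ext fun c => ?_
    rw [pi_eq_sum_univ' c, map_sum]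
    simp [h0]
  obtain ⟨A, hA⟩ := (holoDeriv R x : Cn n →ₗ[ℂ] Cn d).exists_rightInverse_of_surjective hs
  exact ⟨A.toContinuousLinearMap, fun c => LinearMap.congr_fun hA c⟩

end Derivative

/-- An analytic function of `(z, ζ)` that vanishes on `ζ = z̄` vanishes identically. -/
theorem eventually_eq_zero_of_diagonal {n : ℕ} {F : Type*} [NormedAddCommGroup F] [NormedSpace ℂ F]
    [CompleteSpace F] {g : Cn n × Cn n → F} {x : Cn n}
    (hg : AnalyticAt ℂ g (x, star x)) (h0 : ∀ᶠ z in 𝓝 x, g (z, star z) = 0) :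
    ∀ᶠ q in 𝓝 (x, star x), g q = 0 := by
  obtain ⟨ε, hε, h1⟩ := Metric.eventually_nhds_iff_ball.1 hg.eventually_analyticAt
  obtain ⟨δ, hδ, h2⟩ := Metric.eventually_nhds_iff_ball.1 h0
  set r := min ε δ / 3 with hr
  have hr0 : 0 < r := by positivity
  have hrε : 3 * r ≤ ε := by rw [hr]; linarith [min_le_left ε δ]
  have hrδ : 3 * r ≤ δ := by rw [hr]; linarith [min_le_right ε δ]
  filter_upwards [Metric.ball_mem_nhds (x, star x) hr0] with q hq
  rw [Metric.mem_ball, dist_eq_norm, Prod.norm_def, max_lt_iff] at hq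
  obtain ⟨hq1, hq2⟩ := hq
  set a : Cn n := q.1 - x with ha
  set b : Cn n := q.2 - star x with hb
  -- `(a, b) = (u, ū) + i (w, w̄)`: the point `q` lies at `s = i` on the complex line
  -- `s ↦ (x + u + s w, x̄ + ū + s w̄)`, whose points with `s` real satisfy `ζ = z̄`
  set u : Cn n := (1 / 2 : ℂ) • (a + star b) with hu
  set w : Cn n := (-Complex.I / 2) • (a - star b) with hw
  have hun : ‖u‖ < r := by
    have : ‖u‖ ≤ 1 / 2 * (‖a‖ + ‖b‖) := by
      rw [hu, norm_smul]
      have := norm_add_le a (star b)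
      rw [norm_star] at this
      norm_num
      linarith
    have e1 : ‖a‖ < r := hq1
    have e2 : ‖b‖ < r := hq2
    linarith
  have hwn : ‖w‖ < r := by
    have : ‖w‖ ≤ 1 / 2 * (‖a‖ + ‖b‖) := by
      rw [hw, norm_smul]
      have := norm_sub_le a (star b)
      rw [norm_star] at this
      norm_num
      linarith
    have e1 : ‖a‖ < r := hq1
    have e2 : ‖b‖ < r := hq2
    linarith
  have hball : ∀ c : ℂ, ‖c‖ < 2 → ‖u + c • w‖ < 3 * r := by
    intro c hc
    calc ‖u + c • w‖ ≤ ‖u‖ + ‖c‖ * ‖w‖ := (norm_add_le _ _).trans (by rw [norm_smul c w])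
      _ < r + 2 * r := by nlinarith [norm_nonneg w, norm_nonneg c]
      _ = 3 * r := by ring
  let φ : ℂ → F := fun s => g (x + (u + s • w), star x + star (u + star s • w))
  have hφ : AnalyticOnNhd ℂ φ (Metric.ball 0 2) := by
    intro s hs
    have hs' : ‖s‖ < 2 := by simpa using hs
    have hmem : (x + (u + s • w), star x + star (u + star s • w)) ∈
        Metric.ball (x, star x) ε := by
      rw [Metric.mem_ball, dist_eq_norm, Prod.norm_def]
      simp only [Prod.fst_sub, Prod.snd_sub, add_sub_cancel_left, norm_star]
      exact max_lt ((hball s hs').trans_le hrε)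
        ((hball (star s) (by simpa using hs')).trans_le hrε)
    have hin : AnalyticAt ℂ
        (fun s : ℂ => (x + (u + s • w), star x + star (u + star s • w))) s := by
      have e : (fun s : ℂ => (x + (u + s • w), star x + star (u + star s • w))) =
          fun s : ℂ => (x + (u + s • w), star x + (star u + s • star w)) := by
        funext s; simp
      rw [e]
      refine AnalyticAt.prod ?_ ?_
      · exact analyticAt_const.add (analyticAt_const.add (analyticAt_id.smul analyticAt_const))
      · exact analyticAt_const.add (analyticAt_const.add (analyticAt_id.smul analyticAt_const))
    exact AnalyticAt.fun_comp (g := g) (h1 _ hmem) hin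
  have hreal : ∀ t : ℝ, |t| < 2 → φ t = 0 := by
    intro t ht
    have e : φ t = g (x + (u + (t : ℂ) • w), star (x + (u + (t : ℂ) • w))) := by
      simp [φ, star_add]
    rw [e]
    apply h2
    rw [Metric.mem_ball, dist_eq_norm, add_sub_cancel_left]
    exact (hball t (by simpa using ht)).trans_le hrδ
  have hfreq : ∃ᶠ s in 𝓝[≠] (0 : ℂ), φ s = 0 := by
    have ht : Tendsto (fun t : ℝ => (t : ℂ)) (𝓝[≠] 0) (𝓝[≠] 0) := by
      refine tendsto_nhdsWithin_iff.2 ⟨?_, ?_⟩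
      · have : ContinuousAt (fun t : ℝ => (t : ℂ)) 0 := by fun_prop
        simpa using this.tendsto.mono_left nhdsWithin_le_nhds
      · filter_upwards [self_mem_nhdsWithin] with t ht using by simpa using ht
    refine ht.frequently (Eventually.frequently ?_)
    refine nhdsWithin_le_nhds ?_
    filter_upwards [Metric.ball_mem_nhds (0 : ℝ) two_pos] with t ht
    exact hreal t (by simpa using ht)
  have := hφ.eqOn_zero_of_preconnected_of_frequently_eq_zero
    (convex_ball (0 : ℂ) 2).isPreconnected (Metric.mem_ball_self two_pos) hfreq
    (show Complex.I ∈ Metric.ball (0 : ℂ) 2 by simp)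
  have e1 : x + (u + Complex.I • w) = q.1 := by
    have : u + Complex.I • w = a := by
      rw [hu, hw, smul_smul]
      have : Complex.I * (-Complex.I / 2) = 1 / 2 := by
        linear_combination (-1 / 2 : ℂ) * Complex.I_mul_I
      rw [this, ← smul_add, add_add_sub_cancel, ← two_smul ℂ a, smul_smul]
      norm_num
    rw [this, ha]; abel
  have e2 : star x + star (u + star Complex.I • w) = q.2 := by
    have : u + star Complex.I • w = star b := by
      rw [hu, hw, smul_smul]
      have : star Complex.I * (-Complex.I / 2) = -(1 / 2) := by
        simp; linear_combination (-1 / 2 : ℂ) * Complex.I_mul_I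
      rw [this, neg_smul, ← sub_eq_add_neg, ← smul_sub, add_sub_sub_cancel,
        ← two_smul ℂ (star b), smul_smul]
      norm_num
    rw [this, star_star, hb]; abel
  simpa only [φ, e1, e2, Pi.zero_apply, Prod.mk.eta] using this

/-! ### Conjugation of analytic maps -/

section Conjugate

variable {E F : Type*} [NormedAddCommGroup E] [NormedSpace ℂ E] [StarAddMonoid E]
  [NormedStarGroup E] [StarModule ℂ E]
  [NormedAddCommGroup F] [NormedSpace ℂ F] [StarAddMonoid F] [NormedStarGroup F] [StarModule ℂ F]

/-- The conjugate `v ↦ conj (p (conj v))` of a multilinear map. -/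
def conjMultilinear {m : ℕ} (p : ContinuousMultilinearMap ℂ (fun _ : Fin m => E) F) :
    ContinuousMultilinearMap ℂ (fun _ : Fin m => E) F :=
  MultilinearMap.mkContinuous
    { toFun := fun v => star (p fun i => star (v i))
      map_update_add' := by
        intro inst v i a b
        have h (c : E) : (fun j => star (Function.update v i c j)) =
            Function.update (fun j => star (v j)) i (star c) := by
          funext j
          by_cases hj : j = i
          · subst hj; simp
          · simp [hj]
        simp [h]
      map_update_smul' := by
        intro inst v i t a
        have h (c : E) : (fun j => star (Function.update v i c j)) =
            Function.update (fun j => star (v j)) i (star c) := by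
          funext j
          by_cases hj : j = i
          · subst hj; simp
          · simp [hj]
        simp [h] } ‖p‖ (by
      intro v
      simpa using p.le_opNorm fun i => star (v i))

theorem analyticAt_star_star {f : E → F} {z : E} (hf : AnalyticAt ℂ f z) :
    AnalyticAt ℂ (fun w => star (f (star w))) (star z) := by
  obtain ⟨p, r, h⟩ := hf
  refine ⟨fun m => conjMultilinear (p m), r, ?_, h.r_pos, ?_⟩
  · refine h.r_le.trans ?_
    refine iSup_le fun s => iSup₂_le fun C hC => ?_
    refine FormalMultilinearSeries.le_radius_of_bound _ C fun m => (hC m).trans' ?_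
    gcongr
    exact MultilinearMap.mkContinuous_norm_le _ (norm_nonneg _) _
  · intro y hy
    have hy' : star y ∈ Metric.eball (0 : E) r := by
      simpa [edist_zero_right, enorm_eq_nnnorm] using hy
    have := (h.hasSum hy').star
    simpa [conjMultilinear] using this

end Conjugate

/-! ### Straightening the complexification -/

section Straightening

variable {n d : ℕ} {x : Cn n} {ρ : Cn n → Fin d → ℝ} {R : Cn n × Cn n → Cn d}

/-- The antiholomorphic involution `(z, ζ) ↦ (ζ̄, z̄)`, whose fixed points are the `(z, z̄)`. -/
def conjSwap (q : Cn n × Cn n) : Cn n × Cn n := (star q.2, star q.1)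

theorem continuous_conjSwap : Continuous (conjSwap : Cn n × Cn n → Cn n × Cn n) := by
  unfold conjSwap
  fun_prop

theorem conjSwap_add (p q : Cn n × Cn n) : conjSwap (p + q) = conjSwap p + conjSwap q := by
  simp [conjSwap]

theorem conjSwap_sub (p q : Cn n × Cn n) : conjSwap (p - q) = conjSwap p - conjSwap q := by
  simp [conjSwap]

theorem analyticAt_conjMap {p : ℕ} {f : Cn n → Cn p} (hf : AnalyticAt ℂ f x) :
    AnalyticAt ℂ (conjMap f) (star x) := analyticAt_star_star hf

/-- Reality of `ρ` extends to a Hermitian symmetry of `R`. -/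
theorem IsPolarization.eventually_conjSwap (hR : IsPolarization x ρ R) :
    ∀ᶠ q in 𝓝 (x, star x), R (conjSwap q) = star (R q) := by
  have h1 : AnalyticAt ℂ (fun q : Cn n × Cn n => star (R (conjSwap q))) (x, star x) := by
    have h2 : AnalyticAt ℂ (fun q : Cn n × Cn n => R q.swap) (star x, x) :=
      AnalyticAt.fun_comp (f := Prod.swap) hR.analytic
        (analyticAt_snd.prod analyticAt_fst)
    have h3 := analyticAt_star_star h2
    have e : star (star x, x) = (x, star x) := by simp [Prod.star_def]
    rw [e] at h3
    exact h3
  have h2 := eventually_eq_zero_of_diagonal (h1.sub hR.analytic) (by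
    filter_upwards [hR.diagonal] with z hz
    simp only [Pi.sub_apply, conjSwap, star_star, hz]
    funext j
    simp)
  filter_upwards [h2] with q hq
  rw [← sub_eq_zero.1 hq, star_star]

/-- The right inverse `c ↦ (A c, conj (A (conj c))) / 2` of the differential of `R`, commuting with
the conjugations. -/
def realLift (A : Cn d →L[ℂ] Cn n) : Cn d →L[ℂ] Cn n × Cn n :=
  LinearMap.toContinuousLinearMap
    { toFun := fun c => ((1 / 2 : ℂ) • A c, (1 / 2 : ℂ) • star (A (star c)))
      map_add' := fun a b => by simp
      map_smul' := fun t a => by simp [smul_comm t] }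

theorem realLift_apply (A : Cn d →L[ℂ] Cn n) (c : Cn d) :
    realLift A c = ((1 / 2 : ℂ) • A c, (1 / 2 : ℂ) • star (A (star c))) := rfl

theorem conjSwap_realLift (A : Cn d →L[ℂ] Cn n) (c : Cn d) :
    conjSwap (realLift A c) = realLift A (star c) := by
  simp [realLift_apply, conjSwap]

theorem IsPolarization.fderiv_conjSwap (hR : IsPolarization x ρ R) (q : Cn n × Cn n) :
    fderiv ℂ R (x, star x) (conjSwap q) = star (fderiv ℂ R (x, star x) q) := by
  obtain ⟨v, η⟩ := q
  simp only [conjSwap, hR.fderiv_apply]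
  simp [add_comm]

theorem IsPolarization.fderiv_realLift (hR : IsPolarization x ρ R) {A : Cn d →L[ℂ] Cn n}
    (hA : ∀ c, holoDeriv R x (A c) = c) (c : Cn d) :
    fderiv ℂ R (x, star x) (realLift A c) = c := by
  rw [realLift_apply, hR.fderiv_apply]
  simp only [map_smul, star_smul, star_star, hA]
  ext j
  simp
  ring

/-- A local biholomorphism `G` of `ℂⁿ × ℂⁿ`, compatible with the conjugation, that maps the tangent
space of the complexification, realised as the range of a projection `π`, onto the
complexification. -/
theorem IsPolarization.exists_straightening (hR : IsPolarization x ρ R)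
    (hi : LinearIndependent ℂ (fun j : Fin d => del (fun z => ρ z j) x)) (h0 : ρ x = 0) :
    ∃ (π : Cn n × Cn n →L[ℂ] Cn n × Cn n) (G : Cn n × Cn n → Cn n × Cn n),
      (∀ q, fderiv ℂ R (x, star x) (π q) = 0) ∧
      (∀ q, π (conjSwap q) = conjSwap (π q)) ∧
      AnalyticAt ℂ G (x, star x) ∧ G (x, star x) = (x, star x) ∧
      HasFDerivAt G (ContinuousLinearMap.id ℂ (Cn n × Cn n)) (x, star x) ∧
      (∀ᶠ q in 𝓝 (x, star x), R q = 0 → G ((x, star x) + π (q - (x, star x))) = q) ∧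
      ∀ᶠ q in 𝓝 (x, star x), conjSwap q = q → fderiv ℂ R (x, star x) (q - (x, star x)) = 0 →
        conjSwap (G q) = G q ∧ R (G q) = 0 := by
  obtain ⟨A, hA⟩ := hR.exists_rightInverse hi
  set q₀ : Cn n × Cn n := (x, star x) with hq₀
  have hq₀s : conjSwap q₀ = q₀ := by simp [conjSwap, hq₀]
  set D := fderiv ℂ R q₀ with hD
  set B := realLift A with hB
  have hDB (c) : D (B c) = c := hR.fderiv_realLift hA c
  have hR0 : R q₀ = 0 := by
    rw [hq₀, hR.diagonal.self_of_nhds, h0]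
    funext j; simp
  -- `G` is the inverse of `Θ`, which carries `R` to its linear part
  let Θ : Cn n × Cn n → Cn n × Cn n := fun q => q + B (R q - D (q - q₀))
  have hΘ₀ : Θ q₀ = q₀ := by simp [Θ, hR0]
  have hΘa : AnalyticAt ℂ Θ q₀ := by
    refine analyticAt_id.add ((B.analyticAt _).comp (hR.analytic.sub ?_))
    exact (D.analyticAt _).comp (analyticAt_id.sub analyticAt_const)
  have hΘd : HasFDerivAt Θ (ContinuousLinearMap.id ℂ (Cn n × Cn n)) q₀ := by
    have h1 : HasFDerivAt (fun q => D (q - q₀)) D q₀ :=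
      D.hasFDerivAt.comp q₀ ((hasFDerivAt_id q₀).sub_const q₀)
    have h2 := (hasFDerivAt_id q₀).add
      (B.hasFDerivAt.comp q₀ (hR.analytic.differentiableAt.hasFDerivAt.sub h1))
    rw [← hD, sub_self, ContinuousLinearMap.comp_zero, add_zero] at h2
    exact h2
  have hDΘ (q) : D (Θ q - q₀) = R q := by
    have : Θ q - q₀ = (q - q₀) + B (R q - D (q - q₀)) := by simp only [Θ]; abel
    rw [this, map_add, hDB]; abel
  have hΘs : ∀ᶠ q in 𝓝 q₀, Θ (conjSwap q) = conjSwap (Θ q) := by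
    filter_upwards [hR.eventually_conjSwap] with q hq
    have e : D (conjSwap q - q₀) = star (D (q - q₀)) := by
      rw [← hR.fderiv_conjSwap, conjSwap_sub, ← hq₀, hq₀s]
    simp only [Θ]
    rw [hq, e, conjSwap_add, hB, conjSwap_realLift, star_sub]
  have hHa : AnalyticAt ℂ (fun a : (Cn n × Cn n) × (Cn n × Cn n) => Θ a.2 - a.1) (q₀, q₀) :=
    AnalyticAt.sub (AnalyticAt.fun_comp (g := Θ) (f := Prod.snd) hΘa analyticAt_snd)
      analyticAt_fst
  obtain ⟨G, hG, hG0, hG1, hG2⟩ := exists_implicit hHa (by simp [hΘ₀])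
    (ContinuousLinearEquiv.refl ℂ _) (hΘd.sub_const q₀)
  -- `G q` is the only point near `q₀` that `Θ` sends to `q`
  have hG1' : ∀ᶠ a in 𝓝 (q₀, q₀), Θ a.2 = a.1 → a.2 = G a.1 := by
    filter_upwards [hG1] with a ha h
    exact ha.1 (sub_eq_zero.2 h)
  have hG2' : ∀ᶠ q in 𝓝 q₀, Θ (G q) = q := by
    filter_upwards [hG2] with q hq using sub_eq_zero.1 hq
  have hGt : Tendsto G (𝓝 q₀) (𝓝 q₀) := by
    have := hG.continuousAt.tendsto
    rwa [hG0] at this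
  refine ⟨ContinuousLinearMap.id ℂ _ - B.comp D, G, ?_, ?_, hG, hG0, ?_, ?_, ?_⟩
  · intro q; simp [hDB]
  · intro q
    have e : D (conjSwap q) = star (D q) := hR.fderiv_conjSwap q
    simp only [sub_apply, ContinuousLinearMap.id_apply, ContinuousLinearMap.comp_apply]
    rw [conjSwap_sub, e, hB, conjSwap_realLift]
  · have h1 : HasFDerivAt (fun q => Θ (G q)) _ q₀ :=
      HasFDerivAt.comp q₀ (by rwa [hG0]) hG.differentiableAt.hasFDerivAt
    have h2 : HasFDerivAt (fun q => Θ (G q)) (ContinuousLinearMap.id ℂ (Cn n × Cn n)) q₀ :=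
      (hasFDerivAt_id q₀).congr_of_eventuallyEq hG2'
    have h3 := h1.unique h2
    rw [ContinuousLinearMap.id_comp] at h3
    rw [← h3]
    exact hG.differentiableAt.hasFDerivAt
  · have ht : Tendsto (fun q => (Θ q, q)) (𝓝 q₀) (𝓝 (q₀, q₀)) := by
      have := hΘa.continuousAt.tendsto
      rw [hΘ₀] at this
      exact this.prodMk_nhds tendsto_id
    filter_upwards [ht.eventually hG1'] with q hq hRq
    have e : q₀ + (ContinuousLinearMap.id ℂ (Cn n × Cn n) - B.comp D) (q - q₀) = Θ q := by
      simp [Θ, hRq]; abel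
    rw [e]
    exact (hq rfl).symm
  · have ht : Tendsto (fun q => (q, conjSwap (G q))) (𝓝 q₀) (𝓝 (q₀, q₀)) := by
      have := (continuous_conjSwap.tendsto q₀).comp hGt
      rw [hq₀s] at this
      exact tendsto_id.prodMk_nhds this
    filter_upwards [ht.eventually hG1', hG2', hGt.eventually hΘs] with q h1 h2 h3 hq hDq
    refine ⟨h1 ?_, ?_⟩
    · rw [h3, h2, hq]
    · rw [← hDΘ, h2, hDq]

/-- `M` is a maximally real submanifold of its complexification, hence a uniqueness set for
holomorphic functions there. -/
theorem IsPolarization.eventually_eq_zero_on_complexification (hR : IsPolarization x ρ R)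
    (hi : LinearIndependent ℂ (fun j : Fin d => del (fun z => ρ z j) x)) (h0 : ρ x = 0)
    {F : Type*} [NormedAddCommGroup F] [NormedSpace ℂ F] [CompleteSpace F] {g : Cn n × Cn n → F}
    (hg : AnalyticAt ℂ g (x, star x)) (hg0 : ∀ᶠ z in 𝓝 x, ρ z = 0 → g (z, star z) = 0) :
    ∀ᶠ q in 𝓝 (x, star x), R q = 0 → g q = 0 := by
  obtain ⟨π, G, hπ, hπs, hG, hG0, -, hG1, hG2⟩ := hR.exists_straightening hi h0
  set q₀ : Cn n × Cn n := (x, star x) with hq₀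
  have hq₀s : conjSwap q₀ = q₀ := by simp [conjSwap, hq₀]
  have hca : AnalyticAt ℂ (fun q => q₀ + π (q - q₀)) q₀ :=
    analyticAt_const.add ((π.analyticAt _).comp (analyticAt_id.sub analyticAt_const))
  have hc0 : q₀ + π (q₀ - q₀) = q₀ := by simp
  have hGc : AnalyticAt ℂ (fun q => G (q₀ + π (q - q₀))) q₀ :=
    AnalyticAt.fun_comp (g := G) (by rwa [hc0]) hca
  have hha : AnalyticAt ℂ (fun q => g (G (q₀ + π (q - q₀)))) q₀ :=
    AnalyticAt.fun_comp (g := g) (by rwa [hc0, hG0]) hGc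
  have hct : Tendsto (fun q => q₀ + π (q - q₀)) (𝓝 q₀) (𝓝 q₀) := by
    have := hca.continuousAt.tendsto
    rwa [hc0] at this
  have hGt : Tendsto (fun q => G (q₀ + π (q - q₀))) (𝓝 q₀) (𝓝 q₀) := by
    have := hGc.continuousAt.tendsto
    rwa [hc0, hG0] at this
  have hdiag : Tendsto (fun z : Cn n => (z, star z)) (𝓝 x) (𝓝 q₀) := by
    have : ContinuousAt (fun z : Cn n => (z, star z)) x := by fun_prop
    exact this
  have hfst : Tendsto (fun q : Cn n × Cn n => (G (q₀ + π (q - q₀))).1) (𝓝 q₀) (𝓝 x) :=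
    (continuous_fst.tendsto q₀).comp hGt
  -- `g ∘ G` on the tangent space is extended to `ℂⁿ × ℂⁿ` by means of `π`
  have key := eventually_eq_zero_of_diagonal hha (by
    filter_upwards [hdiag.eventually (hct.eventually hG2), hdiag.eventually (hfst.eventually hg0),
      hdiag.eventually (hfst.eventually hR.diagonal)] with z h1 h2 h3
    obtain ⟨h4, h5⟩ := h1 (by
      rw [conjSwap_add, ← hπs, conjSwap_sub, hq₀s]
      simp [conjSwap]) (by
      rw [add_sub_cancel_left, hπ])
    set y := G (q₀ + π ((z, star z) - q₀)) with hy
    have h6 : (y.1, star y.1) = y := Prod.ext rfl (show star y.1 = y.2 from congrArg Prod.snd h4)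
    rw [h6, h5] at h3
    rw [h6] at h2
    refine h2 ?_
    funext j
    simpa using (congrFun h3 j).symm)
  filter_upwards [key, hG1] with q h1 h2 hq
  rw [← h2 hq]
  exact h1

/-- `T^c_x M` is contained in the kernel of `∂ρ`. -/
theorem IsDefining.holoDeriv_eq_zero {M : Set (Cn n)} (hρ : IsDefining M x ρ)
    (hR : IsPolarization x ρ R) {v : Cn n} (hv : v ∈ complexTangent M x) :
    holoDeriv R x v = 0 := by
  have key : ∀ u ∈ tangentVectors M x, ∀ j, (holoDeriv R x u j).re = 0 := by
    rintro u ⟨γ, hγ0, hγM, hγ⟩ j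
    have h1 : HasFDerivAt (fun z => ρ z j) (fderiv ℝ (fun z => ρ z j) x) (γ 0) := by
      rw [hγ0]; exact (hR.differentiableAt j).hasFDerivAt
    have h2 := h1.comp_hasDerivAt 0 hγ
    have hγt : Tendsto γ (𝓝 0) (𝓝 x) := by
      have := hγ.continuousAt.tendsto
      rwa [hγ0] at this
    have h3 : (fun z => ρ z j) ∘ γ =ᶠ[𝓝 0] fun _ => 0 := by
      filter_upwards [hγM, hγt.eventually hρ.zero_set] with t ht ht'
      simp [ht'.1 ht]
    have h4 := h2.unique ((hasDerivAt_const (0 : ℝ) (0 : ℝ)).congr_of_eventuallyEq h3)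
    rw [hR.fderiv_eq_re] at h4
    linarith
  obtain ⟨h1, u, hu, rfl⟩ := hv
  funext j
  apply Complex.ext
  · exact key _ h1 j
  · have := key u hu j
    simpa using this

/-- The kernel of `∂ρ` is contained in `T^c_x M`. -/
theorem IsDefining.mem_complexTangent {M : Set (Cn n)} (hρ : IsDefining M x ρ)
    (hR : IsPolarization x ρ R) (h0 : ρ x = 0) {v : Cn n} (hv : holoDeriv R x v = 0) :
    v ∈ complexTangent M x := by
  have key : ∀ u, holoDeriv R x u = 0 → u ∈ tangentVectors M x := by
    intro u hu
    obtain ⟨π, G, hπ, hπs, hG, hG0, hGd, hG1, hG2⟩ := hR.exists_straightening hρ.independent h0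
    have hc : HasDerivAt (fun t : ℝ => (x, star x) + (t : ℂ) • (u, star u)) (u, star u) 0 := by
      have h1 : HasDerivAt (fun t : ℝ => (t : ℂ)) 1 0 := Complex.ofRealCLM.hasDerivAt
      have := (h1.smul_const (u, star u)).const_add (x, star x)
      simpa using this
    have hc0 : (x, star x) + ((0 : ℝ) : ℂ) • (u, star u) = (x, star x) := by simp
    have hGc : HasDerivAt (fun t : ℝ => G ((x, star x) + (t : ℂ) • (u, star u))) (u, star u) 0 := by
      have h1 : HasFDerivAt G ((ContinuousLinearMap.id ℂ (Cn n × Cn n)).restrictScalars ℝ)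
          ((x, star x) + ((0 : ℝ) : ℂ) • (u, star u)) := by
        rw [hc0]; exact hGd.restrictScalars ℝ
      exact h1.comp_hasDerivAt 0 hc
    have hct : Tendsto (fun t : ℝ => (x, star x) + (t : ℂ) • (u, star u)) (𝓝 0)
        (𝓝 (x, star x)) := by
      have := hc.continuousAt.tendsto
      rwa [hc0] at this
    have hfst : HasDerivAt (fun t : ℝ => (G ((x, star x) + (t : ℂ) • (u, star u))).1) u 0 :=
      (ContinuousLinearMap.fst ℝ (Cn n) (Cn n)).hasFDerivAt.comp_hasDerivAt 0 hGc
    have hf0 : (G ((x, star x) + ((0 : ℝ) : ℂ) • (u, star u))).1 = x := by rw [hc0, hG0]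
    have hft := hfst.continuousAt.tendsto
    rw [hf0] at hft
    refine ⟨_, hf0, ?_, hfst⟩
    filter_upwards [hct.eventually hG2, hft.eventually hρ.zero_set,
      hft.eventually hR.diagonal] with t h1 h2 h3
    obtain ⟨h4, h5⟩ := h1 (by simp [conjSwap]) (by
      rw [add_sub_cancel_left, map_smul, hR.fderiv_apply, star_star, hu]; simp)
    rw [h2]
    set y := G ((x, star x) + (t : ℂ) • (u, star u)) with hy
    have h6 : (y.1, star y.1) = y := Prod.ext rfl (show star y.1 = y.2 from congrArg Prod.snd h4)
    rw [h6, h5] at h3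
    funext j
    simpa using (congrFun h3 j).symm
  refine ⟨key v hv, -(Complex.I • v), key _ (by simp [hv]), ?_⟩
  rw [smul_neg, smul_smul, Complex.I_mul_I]
  simp

/-- A holomorphic parametrisation `t ↦ ψ (t, ζ)` of the Segre varieties `{z : R (z, ζ) = 0}` by
a redundant parameter `t ∈ ℂⁿ`, such that every point `z` is parametrised by `t = z`. -/
theorem IsPolarization.exists_segre_param (hR : IsPolarization x ρ R)
    (hi : LinearIndependent ℂ (fun j : Fin d => del (fun z => ρ z j) x)) (h0 : ρ x = 0) :
    ∃ ψ : Cn n × Cn n → Cn n, AnalyticAt ℂ ψ (x, star x) ∧ ψ (x, star x) = x ∧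
      (∀ᶠ q in 𝓝 (x, star x), R (ψ q, q.2) = 0) ∧
      (∀ᶠ q in 𝓝 (x, star x), R q = 0 → ψ q = q.1) ∧
      ∀ v, holoDeriv R x v = 0 → fderiv ℂ (fun t => ψ (t, star x)) x v = v := by
  obtain ⟨A, hA⟩ := hR.exists_rightInverse hi
  set D := holoDeriv R x with hD
  have hR0 : R (x, star x) = 0 := by
    rw [hR.diagonal.self_of_nhds, h0]
    funext j; simp
  -- a projection onto the kernel of `∂ρ`
  set π : Cn n →L[ℂ] Cn n := ContinuousLinearMap.id ℂ (Cn n) - A.comp D with hπ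
  have hπD (v) : D (π v) = 0 := by simp [hπ, hA]
  -- for `R (z, ζ) = 0` the equation `H ((t, ζ), z) = 0` holds with `t = z`
  let H : (Cn n × Cn n) × Cn n → Cn n := fun a =>
    a.2 + A (R (a.2, a.1.2) - D (a.2 - x)) - (x + π (a.1.1 - x))
  have hDR : HasFDerivAt (fun z => R (z, star x)) D x :=
    HasFDerivAt.comp (g := R) x hR.analytic.differentiableAt.hasFDerivAt
      (hasFDerivAt_prodMk_left x (star x))
  have hDs : HasFDerivAt (fun z => D (z - x)) D x :=
    D.hasFDerivAt.comp x ((hasFDerivAt_id x).sub_const x)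
  have hHd : HasFDerivAt (fun z => H ((x, star x), z)) (ContinuousLinearMap.id ℂ (Cn n)) x := by
    have h2 := ((hasFDerivAt_id x).add
      (A.hasFDerivAt.comp x (hDR.sub hDs))).sub_const (x + π (x - x))
    rw [sub_self D, ContinuousLinearMap.comp_zero, add_zero] at h2
    exact h2
  have hHa : AnalyticAt ℂ H ((x, star x), x) := by
    have h1 : AnalyticAt ℂ (fun a : (Cn n × Cn n) × Cn n => R (a.2, a.1.2)) ((x, star x), x) :=
      AnalyticAt.fun_comp (g := R) hR.analytic
        (analyticAt_snd.prod ((analyticAt_snd (𝕜 := ℂ)).comp analyticAt_fst))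
    refine (analyticAt_snd.add ((A.analyticAt _).comp (h1.sub ?_))).sub (analyticAt_const.add ?_)
    · exact (D.analyticAt _).comp (analyticAt_snd.sub analyticAt_const)
    · exact (π.analyticAt _).comp (((analyticAt_fst (𝕜 := ℂ)).comp analyticAt_fst).sub
        analyticAt_const)
  obtain ⟨ψ, hψ, hψ0, hψ1, hψ2⟩ := exists_implicit hHa (by simp [H, hR0])
    (ContinuousLinearEquiv.refl ℂ _) hHd
  refine ⟨ψ, hψ, hψ0, ?_, ?_, ?_⟩
  · filter_upwards [hψ2] with q hq
    have h1 := congrArg D hq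
    have e : H (q, ψ q) = (ψ q - x) + A (R (ψ q, q.2) - D (ψ q - x)) - π (q.1 - x) := by
      simp only [H]; abel
    rw [e, map_sub, map_add, hA, hπD, map_zero] at h1
    simpa using h1
  · have ht : Tendsto (fun q : Cn n × Cn n => (q, q.1)) (𝓝 (x, star x))
        (𝓝 ((x, star x), x)) := tendsto_id.prodMk_nhds (continuous_fst.tendsto (x, star x))
    filter_upwards [ht.eventually hψ1] with q hq hRq
    refine (hq.1 ?_).symm
    simp [H, hπ, hRq]
    abel
  · intro v hv
    have hψt : HasFDerivAt (fun t => ψ (t, star x)) (fderiv ℂ (fun t => ψ (t, star x)) x) x :=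
      hψ.along_fst.differentiableAt.hasFDerivAt
    set S := fderiv ℂ (fun t => ψ (t, star x)) x with hS
    have hx : ψ (x, star x) = x := hψ0
    have h1 : HasFDerivAt (fun t => R (ψ (t, star x), star x)) (D.comp S) x :=
      HasFDerivAt.comp (g := fun z => R (z, star x)) x (by rwa [hx]) hψt
    have h2 : HasFDerivAt (fun t => D (ψ (t, star x) - x)) (D.comp S) x :=
      D.hasFDerivAt.comp x (hψt.sub_const x)
    have h3 : HasFDerivAt (fun t => x + π (t - x)) π x :=
      (π.hasFDerivAt.comp x ((hasFDerivAt_id x).sub_const x)).const_add x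
    have h4 := (hψt.add (A.hasFDerivAt.comp x (h1.sub h2))).sub h3
    rw [sub_self, ContinuousLinearMap.comp_zero, add_zero] at h4
    have ht : Tendsto (fun t : Cn n => (t, star x)) (𝓝 x) (𝓝 (x, star x)) :=
      tendsto_id.prodMk_nhds tendsto_const_nhds
    have h5 := h4.unique
      ((hasFDerivAt_const (0 : Cn n) x).congr_of_eventuallyEq (ht.eventually hψ2))
    have h6 := DFunLike.congr_fun h5 v
    have h7 : S v = π v := sub_eq_zero.1 h6
    rw [h7]
    simp [hπ, hv]

end Straightening

/-! ### Segre graphs of the target and pull-backs of jets -/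

section Target

variable {n m d r : ℕ} {x : Cn n} {ρ : Cn n → Fin d → ℝ} {R : Cn n × Cn n → Cn d}
  {L : (Cn m × Cn d) ≃L[ℂ] Cn n} {Φ : Cn m × Cn n → Cn d}

/-- The function `v - Φ (u, ζ)` of `(z, ζ)`, where `z = L (u, v)`; its zeros form the
complexification. -/
def graphDefect (L : (Cn m × Cn d) ≃L[ℂ] Cn n) (Φ : Cn m × Cn n → Cn d) (b : Cn n × Cn n) : Cn d :=
  (L.symm b.1).2 - Φ ((L.symm b.1).1, b.2)

theorem IsSegreGraph.eventually_iff (h : IsSegreGraph x R L Φ) :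
    ∀ᶠ b in 𝓝 (x, star x), R b = 0 ↔ graphDefect L Φ b = 0 := by
  have ht : Tendsto (fun b : Cn n × Cn n => (L.symm b.1, b.2)) (𝓝 (x, star x))
      (𝓝 (L.symm x, star x)) := by
    have : ContinuousAt (fun b : Cn n × Cn n => (L.symm b.1, b.2)) (x, star x) := by fun_prop
    exact this
  filter_upwards [ht.eventually h.graph] with b hb
  simpa [graphDefect, sub_eq_zero] using hb

theorem IsSegreGraph.analyticAt_graphDefect (h : IsSegreGraph x R L Φ) :
    AnalyticAt ℂ (graphDefect L Φ) (x, star x) := by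
  have h1 : AnalyticAt ℂ (fun b : Cn n × Cn n => L.symm b.1) (x, star x) :=
    ((L.symm : Cn n →L[ℂ] Cn m × Cn d).analyticAt _).comp analyticAt_fst
  have h2 : AnalyticAt ℂ (fun b : Cn n × Cn n => (L.symm b.1).1) (x, star x) :=
    (analyticAt_fst (𝕜 := ℂ)).comp h1
  have h3 : AnalyticAt ℂ (fun b : Cn n × Cn n => (L.symm b.1).2) (x, star x) :=
    (analyticAt_snd (𝕜 := ℂ)).comp h1
  exact h3.sub (AnalyticAt.fun_comp (g := Φ) h.analytic (h2.prod analyticAt_snd))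

theorem IsSegreGraph.base_eq (h : IsSegreGraph x R L Φ) (hR0 : R (x, star x) = 0) :
    Φ ((L.symm x).1, star x) = (L.symm x).2 := by
  have := h.graph.self_of_nhds
  simp only [ContinuousLinearEquiv.apply_symm_apply] at this
  exact (this.1 hR0).symm

theorem IsSegreGraph.eventually_on_graph (h : IsSegreGraph x R L Φ) (hR0 : R (x, star x) = 0) :
    ∀ᶠ a in 𝓝 ((L.symm x).1, star x), R (L (a.1, Φ a), a.2) = 0 := by
  have ht : Tendsto (fun a : Cn m × Cn n => ((a.1, Φ a), a.2)) (𝓝 ((L.symm x).1, star x))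
      (𝓝 (L.symm x, star x)) := by
    have h1 := h.analytic.continuousAt.tendsto
    rw [h.base_eq hR0] at h1
    exact ((continuous_fst.tendsto _).prodMk_nhds h1).prodMk_nhds (continuous_snd.tendsto _)
  filter_upwards [ht.eventually h.graph] with a ha
  exact ha.2 rfl

/-- The kernel of `∂ρ` projects onto the space of the graphing variables `u`. -/
theorem IsSegreGraph.exists_tangent (h : IsSegreGraph x R L Φ) (hRa : AnalyticAt ℂ R (x, star x))
    (hR0 : R (x, star x) = 0) (u : Cn m) : ∃ v, holoDeriv R x v = 0 ∧ (L.symm v).1 = u := by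
  have hΦ : HasFDerivAt (fun s => Φ (s, star x)) (fderiv ℂ (fun s => Φ (s, star x)) (L.symm x).1)
      (L.symm x).1 := h.analytic.along_fst.differentiableAt.hasFDerivAt
  set S := fderiv ℂ (fun s => Φ (s, star x)) (L.symm x).1 with hS
  refine ⟨L (u, S u), ?_, by simp⟩
  have h1 : HasFDerivAt (fun s => L (s, Φ (s, star x)))
      ((L : (Cn m × Cn d) →L[ℂ] Cn n).comp ((ContinuousLinearMap.id ℂ (Cn m)).prod S))
      (L.symm x).1 :=
    (L : (Cn m × Cn d) →L[ℂ] Cn n).hasFDerivAt.comp (L.symm x).1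
      ((hasFDerivAt_id _).prodMk hΦ)
  have hb : L ((L.symm x).1, Φ ((L.symm x).1, star x)) = x := by
    rw [h.base_eq hR0]; simp
  have hDR : HasFDerivAt (fun z => R (z, star x)) (holoDeriv R x) x :=
    HasFDerivAt.comp (g := R) x hRa.differentiableAt.hasFDerivAt
      (hasFDerivAt_prodMk_left x (star x))
  have h2 : HasFDerivAt (fun s => R (L (s, Φ (s, star x)), star x)) _ (L.symm x).1 :=
    HasFDerivAt.comp (g := fun z => R (z, star x)) (L.symm x).1 (by rwa [hb]) h1
  have ht : Tendsto (fun s : Cn m => (s, star x)) (𝓝 (L.symm x).1)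
      (𝓝 ((L.symm x).1, star x)) := tendsto_id.prodMk_nhds tendsto_const_nhds
  have h3 := h2.unique ((hasFDerivAt_const (0 : Cn d) _).congr_of_eventuallyEq
    (ht.eventually (h.eventually_on_graph hR0)))
  exact DFunLike.congr_fun h3 u

/-- Finite nondegeneracy makes `ζ ↦ j^r Φ (·, ζ)` an immersion on all of `ℂⁿ`, not only along the
conjugate of `Q_x`: the `0`-jet detects the directions transversal to it. -/
theorem IsSegreGraph.jet_immersion (h : IsSegreGraph x R L Φ) (hR : IsPolarization x ρ R)
    (hi : LinearIndependent ℂ (fun j : Fin d => del (fun z => ρ z j) x))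
    (hR0 : R (x, star x) = 0)
    (hrank : Module.finrank ℂ (Submodule.map
      (fderiv ℂ (fun ζ => jet r (fun u => Φ (u, ζ)) (L.symm x).1) (star x)).toLinearMap
      (LinearMap.ker (fderiv ℂ (fun ζ => R (x, ζ)) (star x)).toLinearMap)) = m)
    {η : Cn n} (hη : fderiv ℂ (fun ζ => jet r (fun u => Φ (u, ζ)) (L.symm x).1) (star x) η = 0) :
    η = 0 := by
  set u₀ := (L.symm x).1 with hu₀
  have hJ : HasFDerivAt (fun ζ => jet r (fun u => Φ (u, ζ)) u₀)
      (fderiv ℂ (fun ζ => jet r (fun u => Φ (u, ζ)) u₀) (star x)) (star x) :=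
    ((analyticAt_jet_slice (k := r) h.analytic).along_snd).differentiableAt.hasFDerivAt
  set J := fderiv ℂ (fun ζ => jet r (fun u => Φ (u, ζ)) u₀) (star x) with hJdef
  have hN : HasFDerivAt (fun ζ => R (x, ζ))
      ((fderiv ℂ R (x, star x)).comp (ContinuousLinearMap.inr ℂ (Cn n) (Cn n))) (star x) :=
    HasFDerivAt.comp (g := R) (star x) hR.analytic.differentiableAt.hasFDerivAt
      (hasFDerivAt_prodMk_right x (star x))
  rw [hN.fderiv] at hrank
  set N := (fderiv ℂ R (x, star x)).comp (ContinuousLinearMap.inr ℂ (Cn n) (Cn n)) with hNdef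
  have hNapp (c : Cn n) : N c = star (holoDeriv R x (star c)) := by
    simp [hNdef, hR.fderiv_apply]
  -- the `0`-jet shows that `η` is tangent to the conjugate of `Q_x`
  have hΦ : HasFDerivAt (fun ζ => Φ (u₀, ζ)) ((jetValue m d r).comp J) (star x) := by
    have := (jetValue m d r).hasFDerivAt.comp (star x) hJ
    refine this.congr_of_eventuallyEq (Eventually.of_forall fun ζ => ?_)
    exact (jetValue_jet (fun u => Φ (u, ζ)) u₀).symm
  have hηN : η ∈ LinearMap.ker N.toLinearMap := by
    have h1 : HasFDerivAt (fun ζ => (L (u₀, Φ (u₀, ζ)), ζ))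
        (((L : (Cn m × Cn d) →L[ℂ] Cn n).comp
          ((0 : Cn n →L[ℂ] Cn m).prod ((jetValue m d r).comp J))).prod
          (ContinuousLinearMap.id ℂ (Cn n))) (star x) :=
      ((L : (Cn m × Cn d) →L[ℂ] Cn n).hasFDerivAt.comp (star x)
        ((hasFDerivAt_const _ _).prodMk hΦ)).prodMk (hasFDerivAt_id _)
    have hb : L (u₀, Φ (u₀, star x)) = x := by
      rw [hu₀, h.base_eq hR0]; simp
    have h2 : HasFDerivAt (fun ζ => R (L (u₀, Φ (u₀, ζ)), ζ)) _ (star x) :=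
      HasFDerivAt.comp (g := R) (star x)
        (by rw [hb]; exact hR.analytic.differentiableAt.hasFDerivAt) h1
    have ht : Tendsto (fun ζ : Cn n => (u₀, ζ)) (𝓝 (star x)) (𝓝 (u₀, star x)) :=
      tendsto_const_nhds.prodMk_nhds tendsto_id
    have h3 := h2.unique ((hasFDerivAt_const (0 : Cn d) _).congr_of_eventuallyEq
      (ht.eventually (h.eventually_on_graph hR0)))
    have h4 := DFunLike.congr_fun h3 η
    have h5 : fderiv ℂ R (x, star x) (L (0, jetValue m d r (J η)), η) = 0 := h4
    rw [hη, map_zero, ← Prod.zero_eq_mk, map_zero] at h5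
    exact h5
  have hNs : LinearMap.range N.toLinearMap = ⊤ := by
    obtain ⟨A, hA⟩ := hR.exists_rightInverse hi
    refine LinearMap.range_eq_top.2 fun c => ⟨star (A (star c)), ?_⟩
    exact (hNapp _).trans (by rw [star_star, hA, star_star])
  have hker : Module.finrank ℂ (LinearMap.ker N.toLinearMap) = m := by
    have h1 := LinearMap.finrank_range_add_finrank_ker N.toLinearMap
    have h2 := L.toLinearEquiv.finrank_eq
    rw [hNs, finrank_top] at h1
    simp only [Module.finrank_prod, Module.finrank_fin_fun] at h1 h2
    omega
  have h1 := LinearMap.finrank_range_add_finrank_ker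
    (J.toLinearMap.domRestrict (LinearMap.ker N.toLinearMap))
  rw [LinearMap.range_domRestrict, hrank, hker] at h1
  have h2 : LinearMap.ker (J.toLinearMap.domRestrict (LinearMap.ker N.toLinearMap)) = ⊥ :=
    Submodule.finrank_eq_zero.1 (by omega)
  have h3 := (LinearMap.ker_eq_bot'.1 h2) ⟨η, hηN⟩ hη
  exact congrArg Subtype.val h3

end Target

section Pullback

variable {n m d r N : ℕ}

theorem exists_local_section {χ : Cn n → Cn m} {x : Cn n} (hχ : AnalyticAt ℂ χ x)
    (hs : ∀ u, ∃ v, fderiv ℂ χ x v = u) :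
    ∃ s : Cn m → Cn n, AnalyticAt ℂ s (χ x) ∧ s (χ x) = x ∧ ∀ᶠ u in 𝓝 (χ x), χ (s u) = u := by
  obtain ⟨S, hS⟩ := (fderiv ℂ χ x).toLinearMap.exists_rightInverse_of_surjective
    (LinearMap.range_eq_top.2 hs)
  let S' : Cn m →L[ℂ] Cn n := S.toContinuousLinearMap
  have hS' : (fderiv ℂ χ x).comp S' = ContinuousLinearMap.id ℂ (Cn m) := by
    ext1 u
    exact LinearMap.congr_fun hS u
  have hl : AnalyticAt ℂ (fun y => x + S' y) 0 := analyticAt_const.add (S'.analyticAt _)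
  have hla : AnalyticAt ℂ (fun y => χ (x + S' y)) 0 :=
    AnalyticAt.fun_comp (g := χ) (by simpa using hχ) hl
  have hld : HasFDerivAt (fun y => χ (x + S' y)) (ContinuousLinearMap.id ℂ (Cn m)) 0 := by
    rw [← hS']
    exact HasFDerivAt.comp (g := χ) 0 (by simpa using hχ.differentiableAt.hasFDerivAt)
      (S'.hasFDerivAt.const_add x)
  have hHa : AnalyticAt ℂ (fun a : Cn m × Cn m => χ (x + S' a.2) - a.1) (χ x, 0) :=
    AnalyticAt.sub (AnalyticAt.fun_comp (g := fun y => χ (x + S' y)) (f := Prod.snd) hla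
      analyticAt_snd) analyticAt_fst
  obtain ⟨G, hG, hG0, -, hG1⟩ := exists_implicit hHa (by simp)
    (ContinuousLinearEquiv.refl ℂ _) (hld.sub_const (χ x))
  refine ⟨fun u => x + S' (G u), analyticAt_const.add ((S'.analyticAt _).comp hG),
    by simp [hG0], ?_⟩
  filter_upwards [hG1] with u hu using sub_eq_zero.1 hu

/-- Pulling back by a submersion `χ` loses no information on jets: a direction in parameter space
that is infinitesimally invisible in the jets of `Φ (χ ·, ζ)` is invisible in those of
`Φ (·, ζ)`. -/
theorem fderiv_jet_eq_zero_of_pullback {χ : Cn n → Cn m} {x : Cn n} (hχ : AnalyticAt ℂ χ x)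
    (hs : ∀ u, ∃ v, fderiv ℂ χ x v = u) {Φ : Cn m × Cn N → Cn d} {y : Cn N}
    (hΦ : AnalyticAt ℂ Φ (χ x, y)) {η : Cn N}
    (hη : fderiv ℂ (fun ζ => jet r (fun t => Φ (χ t, ζ)) x) y η = 0) :
    fderiv ℂ (fun ζ => jet r (fun u => Φ (u, ζ)) (χ x)) y η = 0 := by
  obtain ⟨s, hsa, hs0, hs1⟩ := exists_local_section hχ hs
  have hΨ : AnalyticAt ℂ (fun a : Cn n × Cn N => Φ (χ a.1, a.2)) (x, y) :=
    AnalyticAt.fun_comp (g := Φ) hΦ ((hχ.comp analyticAt_fst).prod analyticAt_snd)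
  have hJ := ((analyticAt_jet_slice (k := r) hΨ).along_snd).differentiableAt.hasFDerivAt
  -- `T` recovers the jet of a map at `χ x` from the jet of its pull-back at `x`
  let T : JetFiber n d r → JetFiber m d r := fun j => jet r (fun u => taylorPoly x j (s u)) (χ x)
  have hTa (j : JetFiber n d r) : AnalyticAt ℂ T j := by
    have h1 : AnalyticAt ℂ (fun a : Cn m × JetFiber n d r => taylorPoly x a.2 (s a.1))
        (χ x, j) := by
      exact analyticAt_taylorPoly_comp analyticAt_const analyticAt_snd
        (AnalyticAt.fun_comp (g := s) (f := Prod.fst) hsa analyticAt_fst)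
    exact (analyticAt_jet_slice (k := r) h1).along_snd
  have hev : (fun ζ => jet r (fun u => Φ (u, ζ)) (χ x)) =ᶠ[𝓝 y]
      fun ζ => T (jet r (fun t => Φ (χ t, ζ)) x) := by
    have ht : Tendsto (fun ζ : Cn N => (χ x, ζ)) (𝓝 y) (𝓝 (χ x, y)) :=
      tendsto_const_nhds.prodMk_nhds tendsto_id
    filter_upwards [ht.eventually hΦ.eventually_analyticAt] with ζ hζ
    have h1 : AnalyticAt ℂ (fun t => Φ (χ t, ζ)) x :=
      AnalyticAt.fun_comp (g := fun u => Φ (u, ζ)) hζ.along_fst hχ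
    have h2 := contact_taylorPoly (k := r) h1
    rw [← hs0] at h2
    have h3 := h2.comp_right hsa.differentiableAt
    rw [hs0] at h3
    have h4 : Contact r (fun u => Φ (u, ζ)) (fun u => Φ (χ (s u), ζ)) (χ x) := by
      refine Contact.of_eventuallyEq ?_
      filter_upwards [hs1] with u hu
      rw [hu]
    exact (h4.trans h3).jet_eq hζ.along_fst
      (AnalyticAt.fun_comp (analyticAt_taylorPoly_right _ _ _) hsa)
  rw [hev.fderiv_eq]
  have h5 : HasFDerivAt (fun ζ => T (jet r (fun t => Φ (χ t, ζ)) x)) _ y :=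
    HasFDerivAt.comp (g := T) y (hTa _).differentiableAt.hasFDerivAt hJ
  rw [h5.fderiv, ContinuousLinearMap.comp_apply, hη, map_zero]

theorem jet_sub {f g : Cn n → Cn d} {z : Cn n} (hf : AnalyticAt ℂ f z) (hg : AnalyticAt ℂ g z) :
    jet r (fun t => f t - g t) z = jet r f z - jet r g z := by
  funext σ
  simp only [jet, Pi.sub_apply]
  exact DFunLike.congr_fun (iteratedFDeriv_sub_apply (i := σ.1) hf.contDiffAt hg.contDiffAt) _

end Pullback

/-! ### The reflection identity and its jets -/

section Reflection

variable {n n' d m' d' r : ℕ} {M : Set (Cn n)} {M' : Set (Cn n')} {x : Cn n}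
  {ρ : Cn n → Fin d → ℝ} {R : Cn n × Cn n → Cn d}
  {ρ' : Cn n' → Fin d' → ℝ} {R' : Cn n' × Cn n' → Cn d'}
  {L : (Cn m' × Cn d') ≃L[ℂ] Cn n'} {Φ : Cn m' × Cn n' → Cn d'} {ψ : Cn n × Cn n → Cn n}

/-- The complexification of `f (M) ⊆ M'`: the map `f` sends `Q_w` into `Q'_{f (w)}`. -/
theorem IsAdmissible.eventually_graphDefect {f : Cn n → Cn n'} (hf : IsAdmissible M M' x f)
    (hρ : IsDefining M x ρ) (hR : IsPolarization x ρ R) (h0 : ρ x = 0)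
    (h1 : AnalyticAt ℂ R' (f x, star (f x)))
    (h2 : ∀ᶠ y in 𝓝 (f x), y ∈ M' → ρ' y = 0)
    (h3 : ∀ᶠ y in 𝓝 (f x), R' (y, star y) = fun j => (ρ' y j : ℂ))
    (h4 : ∀ᶠ b in 𝓝 (f x, star (f x)), R' b = 0 → graphDefect L Φ b = 0)
    (hψ : AnalyticAt ℂ ψ (x, star x)) (hψ0 : ψ (x, star x) = x)
    (hψR : ∀ᶠ q in 𝓝 (x, star x), R (ψ q, q.2) = 0) :
    ∀ᶠ q in 𝓝 (x, star x), ∀ᶠ s in 𝓝 q.1,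
      graphDefect L Φ (f (ψ (s, q.2)), conjMap f q.2) = 0 := by
  have hfa := hf.analytic
  have hcf : AnalyticAt ℂ (fun q : Cn n × Cn n => (f q.1, conjMap f q.2)) (x, star x) :=
    (AnalyticAt.fun_comp (g := f) (f := Prod.fst) hfa analyticAt_fst).prod
      (AnalyticAt.fun_comp (g := conjMap f) (f := Prod.snd) (analyticAt_conjMap hfa) analyticAt_snd)
  have hcf0 : (f x, conjMap f (star x)) = (f x, star (f x)) := by simp [conjMap]
  have hcft : Tendsto (fun q : Cn n × Cn n => (f q.1, conjMap f q.2)) (𝓝 (x, star x))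
      (𝓝 (f x, star (f x))) := by
    have := hcf.continuousAt.tendsto
    rwa [hcf0] at this
  have hg : AnalyticAt ℂ (fun q : Cn n × Cn n => R' (f q.1, conjMap f q.2)) (x, star x) :=
    AnalyticAt.fun_comp (g := R') (by rwa [hcf0]) hcf
  have key := hR.eventually_eq_zero_on_complexification hρ.independent h0 hg (by
    filter_upwards [hρ.zero_set, eventually_nhdsWithin_iff.1 hf.maps,
      hfa.continuousAt.tendsto.eventually h2, hfa.continuousAt.tendsto.eventually h3]
      with z g1 g2 g3 g4 hz
    have g5 : conjMap f (star z) = star (f z) := by simp [conjMap]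
    rw [g5, g4, g3 (g2 (g1.2 hz))]
    funext j
    simp)
  have hψt : Tendsto (fun q : Cn n × Cn n => (ψ q, q.2)) (𝓝 (x, star x)) (𝓝 (x, star x)) := by
    have := hψ.continuousAt.tendsto
    rw [hψ0] at this
    exact this.prodMk_nhds (continuous_snd.tendsto _)
  have hall : ∀ᶠ q in 𝓝 (x, star x), graphDefect L Φ (f (ψ q), conjMap f q.2) = 0 := by
    filter_upwards [hψt.eventually key, hψt.eventually (hcft.eventually h4), hψR] with q g1 g2 g3
    exact g2 (g1 g3)
  filter_upwards [hall.eventually_nhds] with q hq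
  have ht : Tendsto (fun s : Cn n => (s, q.2)) (𝓝 q.1) (𝓝 q) :=
    tendsto_id.prodMk_nhds tendsto_const_nhds
  exact ht.eventually hq

/-- Pairs of a point `(t, ζ)` of `ℂⁿ × ℂⁿ` and an `r`-jet. -/
abbrev JetVars (n n' r : ℕ) : Type := (Cn n × Cn n) × JetFiber n n' r

/-- The variables `(t, ζ)`, `j` and `ζ'` of the reflection system. -/
abbrev ReflectionVars (n n' r : ℕ) : Type := JetVars n n' r × Cn n'

/-- The system of equations for `ζ' = f̄ (ζ)` in terms of the point `(t, ζ)` and the `r`-jet `j` of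
`f` at `z = ψ (t, ζ)`: along the Segre variety of `ζ`, the map with jet `j` takes values in the
Segre variety of `ζ'` up to order `r` at `z`. -/
def reflectionSystem (L : (Cn m' × Cn d') ≃L[ℂ] Cn n') (Φ : Cn m' × Cn n' → Cn d')
    (ψ : Cn n × Cn n → Cn n) (b : ReflectionVars n n' r) :
    JetFiber n d' r :=
  jet r (fun s => graphDefect L Φ (taylorPoly (ψ b.1.1) b.1.2 (ψ (s, b.1.1.2)), b.2)) b.1.1.1

/-- For the `r`-jet of an actual map `f`, the Taylor polynomial in the reflection system may be
replaced by `f` itself. -/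
theorem reflectionSystem_jet {f : Cn n → Cn n'} {q : Cn n × Cn n} {y : Cn n'}
    (hψ : AnalyticAt ℂ ψ q) (hf : AnalyticAt ℂ f (ψ q))
    (hW : AnalyticAt ℂ (graphDefect L Φ) (f (ψ q), y)) :
    reflectionSystem L Φ ψ ((q, jet r f (ψ q)), y) =
      jet r (fun s => graphDefect L Φ (f (ψ (s, q.2)), y)) q.1 := by
  have hψs : AnalyticAt ℂ (fun s => ψ (s, q.2)) q.1 := hψ.along_fst
  have hT : AnalyticAt ℂ (taylorPoly (ψ q) (jet r f (ψ q))) (ψ q) :=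
    analyticAt_taylorPoly_right _ _ _
  have h1 : Contact r f (taylorPoly (ψ q) (jet r f (ψ q))) (ψ q) := contact_taylorPoly hf
  have hW1 : AnalyticAt ℂ (fun w => graphDefect L Φ (w, y)) (f (ψ q)) := hW.along_fst
  have h2 := h1.comp_left (Φ := fun w => graphDefect L Φ (w, y)) hW1 hf.continuousAt
    hT.continuousAt
  have h3 := Contact.comp_right (h := fun s => ψ (s, q.2)) (t := q.1) h2 hψs.differentiableAt
  refine (h3.jet_eq ?_ ?_).symm
  · exact AnalyticAt.fun_comp (g := fun w => graphDefect L Φ (f w, y)) (f := fun s => ψ (s, q.2))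
      (AnalyticAt.fun_comp (g := fun w => graphDefect L Φ (w, y)) hW1 hf) hψs
  · refine AnalyticAt.fun_comp
      (g := fun w => graphDefect L Φ (taylorPoly (ψ q) (jet r f (ψ q)) w, y))
      (f := fun s => ψ (s, q.2)) (AnalyticAt.fun_comp (g := fun w => graphDefect L Φ (w, y)) ?_ hT)
      hψs
    rwa [← h1.apply_eq]

theorem analyticAt_reflectionSystem {q : Cn n × Cn n} {j : JetFiber n n' r} {y : Cn n'}
    (hψ : AnalyticAt ℂ ψ q)
    (hW : AnalyticAt ℂ (graphDefect L Φ) (taylorPoly (ψ q) j (ψ q), y)) :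
    AnalyticAt ℂ (reflectionSystem (r := r) L Φ ψ) ((q, j), y) := by
  have h1 : AnalyticAt ℂ (fun a : Cn n × ReflectionVars n n' r => ψ a.2.1.1) (q.1, ((q, j), y)) :=
    AnalyticAt.fun_comp (g := ψ) (f := fun a : Cn n × ReflectionVars n n' r => a.2.1.1) hψ
      (by fun_prop)
  have h2 : AnalyticAt ℂ (fun a : Cn n × ReflectionVars n n' r => ψ (a.1, a.2.1.1.2))
      (q.1, ((q, j), y)) :=
    AnalyticAt.fun_comp (g := ψ) (f := fun a : Cn n × ReflectionVars n n' r => (a.1, a.2.1.1.2)) hψ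
      (by fun_prop)
  have h3 : AnalyticAt ℂ (fun a : Cn n × ReflectionVars n n' r => a.2.1.2) (q.1, ((q, j), y)) := by
    fun_prop
  have h4 : AnalyticAt ℂ (fun a : Cn n × ReflectionVars n n' r => a.2.2) (q.1, ((q, j), y)) := by
    fun_prop
  have h5 : AnalyticAt ℂ (fun a : Cn n × ReflectionVars n n' r => graphDefect L Φ
      (taylorPoly (ψ a.2.1.1) a.2.1.2 (ψ (a.1, a.2.1.1.2)), a.2.2)) (q.1, ((q, j), y)) :=
    AnalyticAt.fun_comp (g := graphDefect L Φ) hW ((analyticAt_taylorPoly_comp h1 h3 h2).prod h4)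
  have h6 : AnalyticAt ℂ (fun b : ReflectionVars n n' r => b.1.1.1) ((q, j), y) := by fun_prop
  exact analyticAt_jet_comp h5 h6

/-- The `ζ'`-derivative of the reflection system is injective: `f₀` restricts to a submersion
`Q_x → Q'_{x'}`, and `ζ' ↦ j^r Φ (·, ζ')` is an immersion. -/
theorem reflectionSystem_injective {f₀ : Cn n → Cn n'} (hf₀ : IsAdmissible M M' x f₀)
    (hρ : IsDefining M x ρ) (hR : IsPolarization x ρ R)
    (hψ : AnalyticAt ℂ ψ (x, star x)) (hψ0 : ψ (x, star x) = x)
    (hψd : ∀ v, holoDeriv R x v = 0 → fderiv ℂ (fun t => ψ (t, star x)) x v = v)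
    (hρ' : IsDefining M' (f₀ x) ρ') (hR' : IsPolarization (f₀ x) ρ' R') (h0' : ρ' (f₀ x) = 0)
    (hL : IsSegreGraph (f₀ x) R' L Φ)
    (hrank : Module.finrank ℂ (Submodule.map
      (fderiv ℂ (fun ζ => jet r (fun u => Φ (u, ζ)) (L.symm (f₀ x)).1) (star (f₀ x))).toLinearMap
      (LinearMap.ker (fderiv ℂ (fun ζ => R' (f₀ x, ζ)) (star (f₀ x))).toLinearMap)) = m')
    {η : Cn n'}
    (hη : fderiv ℂ (fun y => reflectionSystem L Φ ψ (((x, star x), jet r f₀ x), y))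
      (star (f₀ x)) η = 0) : η = 0 := by
  have hR0' : R' (f₀ x, star (f₀ x)) = 0 := by
    rw [hR'.diagonal.self_of_nhds, h0']
    funext j; simp
  have hfψ : AnalyticAt ℂ (fun s => f₀ (ψ (s, star x))) x :=
    AnalyticAt.fun_comp (g := f₀) (f := fun s => ψ (s, star x)) (by rw [hψ0]; exact hf₀.analytic)
      hψ.along_fst
  have hLc : AnalyticAt ℂ (fun s => L.symm (f₀ (ψ (s, star x)))) x :=
    ((L.symm : Cn n' →L[ℂ] Cn m' × Cn d').analyticAt _).comp hfψ
  let χ : Cn n → Cn m' := fun s => (L.symm (f₀ (ψ (s, star x)))).1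
  have hχ : AnalyticAt ℂ χ x := (analyticAt_fst (𝕜 := ℂ)).comp hLc
  have hv : AnalyticAt ℂ (fun s => (L.symm (f₀ (ψ (s, star x)))).2) x :=
    (analyticAt_snd (𝕜 := ℂ)).comp hLc
  have hχ0 : χ x = (L.symm (f₀ x)).1 := by simp only [χ, hψ0]
  -- `T^c_x M` is mapped onto `T^c_{x'} M'`, which projects onto the `u`-space
  have hs : ∀ u, ∃ v, fderiv ℂ χ x v = u := by
    intro u
    obtain ⟨w, hw, hwu⟩ := hL.exists_tangent hR'.analytic hR0' u
    have hwT := hρ'.mem_complexTangent hR' h0' hw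
    rw [← hf₀.tangent] at hwT
    obtain ⟨v, hvT, hvw⟩ := hwT
    refine ⟨v, ?_⟩
    have h1 : HasFDerivAt (fun s => f₀ (ψ (s, star x))) _ x :=
      HasFDerivAt.comp (g := f₀) (f := fun s => ψ (s, star x)) x
        (by rw [hψ0]; exact hf₀.analytic.differentiableAt.hasFDerivAt)
        hψ.along_fst.differentiableAt.hasFDerivAt
    have h2 : HasFDerivAt χ _ x :=
      ((ContinuousLinearMap.fst ℂ (Cn m') (Cn d')).comp
        (L.symm : Cn n' →L[ℂ] Cn m' × Cn d')).hasFDerivAt.comp x h1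
    rw [h2.fderiv]
    simp only [ContinuousLinearMap.comp_apply]
    rw [hψd v (hρ.holoDeriv_eq_zero hR hvT), hvw]
    exact hwu
  have hΦ : AnalyticAt ℂ Φ (χ x, star (f₀ x)) := by rw [hχ0]; exact hL.analytic
  have hW : AnalyticAt ℂ (graphDefect L Φ) (f₀ x, star (f₀ x)) := hL.analyticAt_graphDefect
  have hΨ : AnalyticAt ℂ (fun a : Cn n × Cn n' => Φ (χ a.1, a.2)) (x, star (f₀ x)) :=
    AnalyticAt.fun_comp (g := Φ) hΦ
      ((AnalyticAt.fun_comp (g := χ) (f := Prod.fst) hχ analyticAt_fst).prod analyticAt_snd)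
  have hev : (fun y => reflectionSystem L Φ ψ (((x, star x), jet r f₀ x), y)) =ᶠ[𝓝 (star (f₀ x))]
      fun y => jet r (fun s => (L.symm (f₀ (ψ (s, star x)))).2) x -
        jet r (fun s => Φ (χ s, y)) x := by
    have ht : Tendsto (fun y : Cn n' => (f₀ x, y)) (𝓝 (star (f₀ x))) (𝓝 (f₀ x, star (f₀ x))) :=
      tendsto_const_nhds.prodMk_nhds tendsto_id
    have ht' : Tendsto (fun y : Cn n' => (x, y)) (𝓝 (star (f₀ x))) (𝓝 (x, star (f₀ x))) :=
      tendsto_const_nhds.prodMk_nhds tendsto_id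
    filter_upwards [ht.eventually hW.eventually_analyticAt,
      ht'.eventually hΨ.eventually_analyticAt] with y hy hy'
    have h1 := reflectionSystem_jet (r := r) (f := f₀) (y := y) (q := (x, star x)) hψ
      (by rw [hψ0]; exact hf₀.analytic) (by rw [hψ0]; exact hy)
    rw [hψ0] at h1
    rw [h1]
    exact jet_sub hv hy'.along_fst
  have hJ : HasFDerivAt (fun y => jet r (fun s => Φ (χ s, y)) x)
      (fderiv ℂ (fun y => jet r (fun s => Φ (χ s, y)) x) (star (f₀ x))) (star (f₀ x)) :=
    ((analyticAt_jet_slice (k := r) hΨ).along_snd).differentiableAt.hasFDerivAt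
  rw [hev.fderiv_eq, (hJ.const_sub _).fderiv] at hη
  have h1 := fderiv_jet_eq_zero_of_pullback (r := r) hχ hs hΦ (η := η)
    (by simpa using hη)
  rw [hχ0] at h1
  exact hL.jet_immersion hR' hρ'.independent hR0' hrank h1

/-- The reflection identity: `f̄ (ζ)` is an analytic function `G` of `(t, ζ)` and of the `r`-jet of
`f` at `ψ (t, ζ)`; the same `G` serves all admissible `f` with `r`-jet at `x` close to that
of `f₀`. -/
theorem exists_reflection {f₀ : Cn n → Cn n'} (hf₀ : IsAdmissible M M' x f₀) (hx : x ∈ M)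
    (hρ : IsDefining M x ρ) (hR : IsPolarization x ρ R) (hr : IsNondegenerateAt M' r (f₀ x))
    (hψ : AnalyticAt ℂ ψ (x, star x)) (hψ0 : ψ (x, star x) = x)
    (hψR : ∀ᶠ q in 𝓝 (x, star x), R (ψ q, q.2) = 0)
    (hψd : ∀ v, holoDeriv R x v = 0 → fderiv ℂ (fun t => ψ (t, star x)) x v = v) :
    ∃ G : JetVars n n' r → Cn n',
      AnalyticAt ℂ G ((x, star x), jet r f₀ x) ∧
      ∀ᶠ j in 𝓝 (jet r f₀ x), ∀ f : Cn n → Cn n', IsAdmissible M M' x f → jet r f x = j →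
        ∀ᶠ q in 𝓝 (x, star x), conjMap f q.2 = G (q, jet r f (ψ q)) := by
  obtain ⟨-, hx', m', d', ρ', R', L, Φ, hρ', hR', hL, hrank⟩ := hr
  have h0 : ρ x = 0 := hρ.zero_set.self_of_nhds.1 hx
  have h0' : ρ' (f₀ x) = 0 := hρ'.zero_set.self_of_nhds.1 hx'
  -- all that is needed of the data of `M'` at the points `f x` near `f₀ x`
  have hnear : ∀ᶠ y in 𝓝 (f₀ x), AnalyticAt ℂ R' (y, star y) ∧
      AnalyticAt ℂ (graphDefect L Φ) (y, star y) ∧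
      (∀ᶠ w in 𝓝 y, w ∈ M' → ρ' w = 0) ∧
      (∀ᶠ w in 𝓝 y, R' (w, star w) = fun j => (ρ' w j : ℂ)) ∧
      ∀ᶠ b in 𝓝 (y, star y), R' b = 0 → graphDefect L Φ b = 0 := by
    have ht : Tendsto (fun y : Cn n' => (y, star y)) (𝓝 (f₀ x)) (𝓝 (f₀ x, star (f₀ x))) := by
      have : ContinuousAt (fun y : Cn n' => (y, star y)) (f₀ x) := by fun_prop
      exact this
    filter_upwards [ht.eventually hR'.analytic.eventually_analyticAt,
      ht.eventually hL.analyticAt_graphDefect.eventually_analyticAt,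
      hρ'.zero_set.eventually_nhds, hR'.diagonal.eventually_nhds,
      ht.eventually hL.eventually_iff.eventually_nhds] with y g1 g2 g3 g4 g5
    exact ⟨g1, g2, g3.mono fun w hw => hw.1, g4, g5.mono fun w hw => hw.1⟩
  have hvanish : ∀ f : Cn n → Cn n', IsAdmissible M M' x f →
      (AnalyticAt ℂ R' (f x, star (f x)) ∧ AnalyticAt ℂ (graphDefect L Φ) (f x, star (f x)) ∧
      (∀ᶠ w in 𝓝 (f x), w ∈ M' → ρ' w = 0) ∧
      (∀ᶠ w in 𝓝 (f x), R' (w, star w) = fun j => (ρ' w j : ℂ)) ∧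
      ∀ᶠ b in 𝓝 (f x, star (f x)), R' b = 0 → graphDefect L Φ b = 0) →
      ∀ᶠ q in 𝓝 (x, star x),
        reflectionSystem L Φ ψ ((q, jet r f (ψ q)), conjMap f q.2) = 0 := by
    rintro f hf ⟨g1, g2, g3, g4, g5⟩
    have hψt := hψ.continuousAt.tendsto
    rw [hψ0] at hψt
    have hct : Tendsto (fun q : Cn n × Cn n => (f (ψ q), conjMap f q.2)) (𝓝 (x, star x))
        (𝓝 (f x, star (f x))) := by
      have h1 := (analyticAt_conjMap hf.analytic).continuousAt.tendsto.comp
        (continuous_snd.tendsto (x, star x))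
      have h2 : conjMap f (star x) = star (f x) := by simp [conjMap]
      rw [h2] at h1
      exact (hf.analytic.continuousAt.tendsto.comp hψt).prodMk_nhds h1
    filter_upwards [hf.eventually_graphDefect hρ hR h0 g1 g3 g4 g5 hψ hψ0 hψR,
      hψ.eventually_analyticAt, hψt.eventually hf.analytic.eventually_analyticAt,
      hct.eventually g2.eventually_analyticAt] with q e1 e2 e3 e4
    rw [reflectionSystem_jet e2 e3 e4]
    have e5 : Contact r (fun s => graphDefect L Φ (f (ψ (s, q.2)), conjMap f q.2))
        (fun _ => (0 : Cn d')) q.1 := Contact.of_eventuallyEq e1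
    rw [e5.jet_eq ?_ analyticAt_const, jet_zero]
    exact analyticAt_const.congr (EventuallyEq.symm e1)
  have hE0 : reflectionSystem L Φ ψ (((x, star x), jet r f₀ x), star (f₀ x)) = 0 := by
    have := (hvanish f₀ hf₀ hnear.self_of_nhds).self_of_nhds
    rw [hψ0] at this
    simpa [conjMap] using this
  have hEa : AnalyticAt ℂ (reflectionSystem (r := r) L Φ ψ)
      (((x, star x), jet r f₀ x), star (f₀ x)) := by
    refine analyticAt_reflectionSystem hψ ?_
    rw [hψ0, ← (contact_taylorPoly hf₀.analytic).apply_eq]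
    exact hL.analyticAt_graphDefect
  obtain ⟨G, hG, -, hG1⟩ := exists_implicit_of_injective hEa hE0 _
    hEa.along_snd.differentiableAt.hasFDerivAt
    (fun η hη => reflectionSystem_injective hf₀ hρ hR hψ hψ0 hψd hρ' hR' h0' hL hrank hη)
  refine ⟨G, hG, ?_⟩
  have hval : Tendsto (jetValue n n' r) (𝓝 (jet r f₀ x)) (𝓝 (f₀ x)) := by
    have := (jetValue n n' r).continuous.tendsto (jet r f₀ x)
    rwa [jetValue_jet] at this
  have hbase : Tendsto (fun j : JetFiber n n' r => (((x, star x), j), star (jetValue n n' r j)))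
      (𝓝 (jet r f₀ x)) (𝓝 (((x, star x), jet r f₀ x), star (f₀ x))) :=
    (tendsto_const_nhds.prodMk_nhds tendsto_id).prodMk_nhds
      ((continuous_star.tendsto _).comp hval)
  filter_upwards [hbase.eventually hG1.eventually_nhds, hval.eventually hnear] with j e1 e2 f hf hj
  subst hj
  rw [jetValue_jet] at e1 e2
  have ht : Tendsto (fun q : Cn n × Cn n => ((q, jet r f (ψ q)), conjMap f q.2)) (𝓝 (x, star x))
      (𝓝 (((x, star x), jet r f x), star (f x))) := by
    have h1 := (analyticAt_conjMap hf.analytic).continuousAt.tendsto.comp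
      (continuous_snd.tendsto (x, star x))
    have h2 : conjMap f (star x) = star (f x) := by simp [conjMap]
    rw [h2] at h1
    have h3 := hψ.continuousAt.tendsto
    rw [hψ0] at h3
    have h4 := (analyticAt_jet (k := r) hf.analytic).continuousAt.tendsto.comp h3
    exact (tendsto_id.prodMk_nhds h4).prodMk_nhds h1
  filter_upwards [ht.eventually e1, hvanish f hf e2] with q e3 e4
  exact e3 e4

/-- The map `F^k`: differentiate the reflection identity `k` times in `ζ`, with `f` replaced by the
Taylor polynomial of the given jet at `z`. -/
def reflectionJet (k : ℕ) (ψ : Cn n × Cn n → Cn n) (G : JetVars n n' r → Cn n')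
    (p : Cn n × Cn n) (j : JetFiber n n' (k + r)) : JetFiber n n' k :=
  jet k (fun ζ => G ((p.1, ζ), jet r (taylorPoly p.1 j) (ψ (p.1, ζ)))) p.2

theorem analyticAt_reflectionJet {k : ℕ} {G : JetVars n n' r → Cn n'}
    {p : Cn n × Cn n} {j : JetFiber n n' (k + r)} (hψ : AnalyticAt ℂ ψ p)
    (hG : AnalyticAt ℂ G (p, jet r (taylorPoly p.1 j) (ψ p))) :
    AnalyticAt ℂ (fun q : JetVars n n' (k + r) => reflectionJet k ψ G q.1 q.2) (p, j) := by
  have h0 : AnalyticAt ℂ (fun a : Cn n × JetVars n n' (k + r) => (a.2.1.1, a.1)) (p.2, (p, j)) := by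
    fun_prop
  have h1 : AnalyticAt ℂ (fun a : Cn n × JetVars n n' (k + r) => ψ (a.2.1.1, a.1))
      (p.2, (p, j)) := AnalyticAt.fun_comp (g := ψ) hψ h0
  have h2 : AnalyticAt ℂ
      (fun c : Cn n × JetVars n n' (k + r) => taylorPoly c.2.1.1 c.2.2 c.1) (ψ p, (p, j)) :=
    analyticAt_taylorPoly_comp (by fun_prop) (by fun_prop) (by fun_prop)
  have h3 : AnalyticAt ℂ (fun a : Cn n × JetVars n n' (k + r) =>
      jet r (taylorPoly a.2.1.1 a.2.2) (ψ (a.2.1.1, a.1))) (p.2, (p, j)) :=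
    AnalyticAt.fun_comp
      (g := fun c : Cn n × JetVars n n' (k + r) =>
        jet r (fun w => taylorPoly c.2.1.1 c.2.2 w) c.1)
      (f := fun a : Cn n × JetVars n n' (k + r) => (ψ (a.2.1.1, a.1), a.2))
      (analyticAt_jet_slice (k := r) h2) (h1.prod analyticAt_snd)
  have h4 : AnalyticAt ℂ (fun a : Cn n × JetVars n n' (k + r) =>
      G ((a.2.1.1, a.1), jet r (taylorPoly a.2.1.1 a.2.2) (ψ (a.2.1.1, a.1)))) (p.2, (p, j)) :=
    AnalyticAt.fun_comp (g := G) hG (h0.prod h3)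
  have h5 : AnalyticAt ℂ (fun b : JetVars n n' (k + r) => b.1.2) (p, j) := by fun_prop
  exact analyticAt_jet_comp h4 h5

/-- For the `(k + r)`-jet of an actual map `f`, the Taylor polynomial in `reflectionJet` may be
replaced by `f` itself. -/
theorem reflectionJet_jet {k : ℕ} {G : JetVars n n' r → Cn n'}
    {p : Cn n × Cn n} {f : Cn n → Cn n'} (hψ : AnalyticAt ℂ ψ p) (hp : ψ p = p.1)
    (hf : AnalyticAt ℂ f p.1) (hG : AnalyticAt ℂ G (p, jet r f p.1)) :
    reflectionJet k ψ G p (jet (k + r) f p.1) =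
      jet k (fun ζ => G ((p.1, ζ), jet r f (ψ (p.1, ζ)))) p.2 := by
  set T := taylorPoly p.1 (jet (k + r) f p.1) with hT
  have hTa : AnalyticAt ℂ T p.1 := analyticAt_taylorPoly_right _ _ _
  have h1 : Contact k (jet r f) (jet r T) p.1 := (contact_taylorPoly hf).jet hf hTa
  have hψs : AnalyticAt ℂ (fun ζ => ψ (p.1, ζ)) p.2 := hψ.along_snd
  have hpe : ψ (p.1, p.2) = p.1 := hp
  have hcomp {g : Cn n → Cn n'} (hg : AnalyticAt ℂ g p.1) :
      AnalyticAt ℂ (fun ζ => ((p.1, ζ), jet r g (ψ (p.1, ζ)))) p.2 := by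
    have e : AnalyticAt ℂ (fun ζ => jet r g (ψ (p.1, ζ))) p.2 :=
      AnalyticAt.fun_comp (g := jet r g) (f := fun ζ => ψ (p.1, ζ))
        (by rw [hpe]; exact analyticAt_jet hg) hψs
    exact (analyticAt_const.prod analyticAt_id).prod e
  have h2 : Contact k (fun ζ => jet r f (ψ (p.1, ζ))) (fun ζ => jet r T (ψ (p.1, ζ))) p.2 :=
    Contact.comp_right (h := fun ζ => ψ (p.1, ζ)) (by rw [hpe]; exact h1) hψs.differentiableAt
  have h3 : Contact k (fun ζ => ((p.1, ζ), jet r f (ψ (p.1, ζ))))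
      (fun ζ => ((p.1, ζ), jet r T (ψ (p.1, ζ)))) p.2 := by
    refine Asymptotics.IsBigO.trans (Asymptotics.isBigO_of_le _ fun ζ => ?_) h2
    simp [Prod.norm_def]
  have hG1 : AnalyticAt ℂ G ((p.1, p.2), jet r f (ψ (p.1, p.2))) := by rw [hpe]; exact hG
  have h4 := h3.comp_left (Φ := G) hG1 (hcomp hf).continuousAt (hcomp hTa).continuousAt
  refine (h4.jet_eq (AnalyticAt.fun_comp (g := G) hG1 (hcomp hf))
    (AnalyticAt.fun_comp (g := G) ?_ (hcomp hTa))).symm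
  rwa [← h2.apply_eq]

end Reflection

end CRJets

end

theorem proposition3p1 {n n' d : ℕ} (M : Set (CRJets.Cn n)) (M' : Set (CRJets.Cn n'))
    (hM : CRJets.IsGeneric M) (hM' : CRJets.IsGeneric M')
    (x : CRJets.Cn n) (hx : x ∈ M)
    (f₀ : CRJets.Cn n → CRJets.Cn n') (hf₀ : CRJets.IsAdmissible M M' x f₀)
    (r : ℕ) (hr : CRJets.IsNondegenerateAt M' r (f₀ x))
    (ρ : CRJets.Cn n → Fin d → ℝ) (hρ : CRJets.IsDefining M x ρ)
    (R : CRJets.Cn n × CRJets.Cn n → CRJets.Cn d) (hR : CRJets.IsPolarization x ρ R)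
    (k : ℕ) :
    ∃ (U : Set (CRJets.JetBundle n n' (k + r))) (V : Set (CRJets.Cn n × CRJets.Cn n))
      (F : CRJets.Cn n × CRJets.Cn n → CRJets.JetFiber n n' (k + r) → CRJets.JetFiber n n' k),
      IsOpen U ∧ (x, CRJets.jet (k + r) f₀ x) ∈ U ∧ IsOpen V ∧ (x, star x) ∈ V ∧
      -- each `F p` is holomorphic on the fibre of `U` over `z`, where `p = (z, w̄)`
      (∀ p ∈ V ∩ CRJets.complexification R, DifferentiableOn ℂ (F p) {j | (p.1, j) ∈ U}) ∧
      -- `F p` depends holomorphically on `p` in the complexification (jointly with the jet)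
      AnalyticOn ℂ
        (fun q : (CRJets.Cn n × CRJets.Cn n) × CRJets.JetFiber n n' (k + r) => F q.1 q.2)
        {q | q.1 ∈ V ∩ CRJets.complexification R ∧ (q.1.1, q.2) ∈ U} ∧
      ∀ f : CRJets.Cn n → CRJets.Cn n', CRJets.IsAdmissible M M' x f →
        (x, CRJets.jet (k + r) f x) ∈ U →
        ∀ᶠ p in 𝓝[CRJets.complexification R] (x, star x),
          (p.1, CRJets.jet (k + r) f p.1) ∈ U ∧
          CRJets.jet k (CRJets.conjMap f) p.2 = F p (CRJets.jet (k + r) f p.1) := by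
  open CRJets in
  have h0 : ρ x = 0 := hρ.zero_set.self_of_nhds.1 hx
  obtain ⟨ψ, hψ, hψ0, hψR, hψz, hψd⟩ := hR.exists_segre_param hρ.independent h0
  obtain ⟨G, hG, hGf⟩ := exists_reflection hf₀ hx hρ hR hr hψ hψ0 hψR hψd
  -- truncation of `(k + r)`-jets at `x` to `r`-jets
  let τ : JetFiber n n' (k + r) → JetFiber n n' r := fun j => jet r (taylorPoly x j) x
  have hτ : ∀ f : Cn n → Cn n', AnalyticAt ℂ f x → τ (jet (k + r) f x) = jet r f x := by
    intro f hf
    exact (((contact_taylorPoly hf).of_le (Nat.le_add_left r k)).jet_eq hf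
      (analyticAt_taylorPoly_right _ _ _)).symm
  have hτc : Tendsto τ (𝓝 (jet (k + r) f₀ x)) (𝓝 (jet r f₀ x)) := by
    have h1 : AnalyticAt ℂ (fun a : Cn n × JetFiber n n' (k + r) => taylorPoly x a.2 a.1)
        (x, jet (k + r) f₀ x) :=
      analyticAt_taylorPoly_comp analyticAt_const analyticAt_snd analyticAt_fst
    have := ((analyticAt_jet_slice (k := r) h1).along_snd).continuousAt.tendsto
    rw [← hτ f₀ hf₀.analytic]
    exact this
  have hGa : AnalyticAt ℂ G ((x, star x), τ (jet (k + r) f₀ x)) := by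
    rwa [hτ f₀ hf₀.analytic]
  have hFa : ∀ᶠ q in 𝓝 ((x, star x), jet (k + r) f₀ x), AnalyticAt ℂ
      (fun q : (Cn n × Cn n) × JetFiber n n' (k + r) => reflectionJet k ψ G q.1 q.2) q :=
    (analyticAt_reflectionJet hψ (by rw [hψ0]; exact hGa)).eventually_analyticAt
  have hGa' : ∀ᶠ j in 𝓝 (jet r f₀ x), AnalyticAt ℂ G ((x, star x), j) := by
    have ht : Tendsto (fun j : JetFiber n n' r => ((x, star x), j)) (𝓝 (jet r f₀ x))
        (𝓝 ((x, star x), jet r f₀ x)) := tendsto_const_nhds.prodMk_nhds tendsto_id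
    exact ht.eventually hG.eventually_analyticAt
  rw [nhds_prod_eq] at hFa
  obtain ⟨pV, hpV, pJ, hpJ, hVJ⟩ := eventually_prod_iff.1 hFa
  obtain ⟨V, hVs, hVo, hVx⟩ := mem_nhds_iff.1 hpV
  obtain ⟨J, hJs, hJo, hJx⟩ := mem_nhds_iff.1
    (hpJ.and ((hτc.eventually hGf).and (hτc.eventually hGa')))
  refine ⟨Prod.snd ⁻¹' J, V, reflectionJet k ψ G, hJo.preimage continuous_snd, hJx, hVo, hVx,
    ?_, ?_, ?_⟩
  · intro p hp j hj
    have h1 := hVJ (hVs hp.1) (hJs hj).1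
    exact h1.along_snd.differentiableAt.differentiableWithinAt
  · intro q hq
    exact (hVJ (hVs hq.1.1) (hJs hq.2).1).analyticWithinAt
  · intro f hf hfJ
    obtain ⟨-, h1, h2⟩ := hJs hfJ
    have h3 := h1 f hf (hτ f hf.analytic).symm
    rw [hτ f hf.analytic] at h2
    have hfst : Tendsto (Prod.fst : Cn n × Cn n → Cn n) (𝓝 (x, star x)) (𝓝 x) :=
      continuous_fst.tendsto _
    have hjt := (analyticAt_jet (k := k + r) hf.analytic).continuousAt.tendsto.comp hfst
    have hGt : Tendsto (fun q : Cn n × Cn n => (q, jet r f q.1)) (𝓝 (x, star x))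
        (𝓝 ((x, star x), jet r f x)) :=
      tendsto_id.prodMk_nhds
        ((analyticAt_jet (k := r) hf.analytic).continuousAt.tendsto.comp hfst)
    refine eventually_nhdsWithin_iff.2 ?_
    filter_upwards [hjt.eventually (hJo.mem_nhds hfJ), h3.eventually_nhds, hψz,
      hψ.eventually_analyticAt, hfst.eventually hf.analytic.eventually_analyticAt,
      hGt.eventually h2.eventually_analyticAt] with p e1 e2 e3 e4 e5 e6 hp
    refine ⟨e1, ?_⟩
    rw [reflectionJet_jet e4 (e3 hp) e5 e6]
    have e7 : conjMap f =ᶠ[𝓝 p.2] fun ζ => G ((p.1, ζ), jet r f (ψ (p.1, ζ))) := by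
      have ht : Tendsto (fun ζ : Cn n => (p.1, ζ)) (𝓝 p.2) (𝓝 p) :=
        tendsto_const_nhds.prodMk_nhds tendsto_id
      exact ht.eventually e2
    funext σ
    simp only [jet]
    rw [(e7.iteratedFDeriv ℂ σ.1).eq_of_nhds]
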